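/- Let $k$ be an algebraically closed field, let $n\ge 1$, let $V$ be a $k$-vector space of dimension $n+1$, and let $R=\bigwedge V$ be the exterior algebra, graded so that $V$ has degree one. Let $\operatorname{mod} R$ be the category of finitely generated $\mathbb Z$-graded (right) $R$-modules with homomorphisms of degree zero. For a nonzero $\xi\in V$ let $M=M_\xi=R/\langle\xi\rangle$ (the cyclic local module of complexity one and dimension $2^n$, generated in degree zero), and let $\mathcal F(M)$ be the full subcategory of $\operatorname{mod} R$ consisting of the graded modules $X$ that have a finite filtration $0=X_0\subseteq X_1\subseteq\dots\subseteq X_t=X$ by graded submodules with $X_i/X_{i-1}\cong M$ in $\operatorname{mod} R$ for $1\le i\le t$. Then $\mathcal F(M)$ is equivalent, as a $k$-linear category, to the category of modules over the power series ring $k[[t_1,\dots,t_n]]$ that are finite dimensional over $k$. -/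

import Mathlib

open CategoryTheory
open scoped ExteriorAlgebra

universe u

noncomputable section

namespace ExteriorGraded

/-- A finitely generated `ℤ`-graded right module over the exterior algebra `R = ⋀ V`, where `R` is
graded by giving the elements of `V` degree one. Right `R`-modules are modules over `Rᵐᵒᵖ`; the
`k`-space structure is the restriction of the `R`-module structure along `k → R`. -/
structure GrMod (k V : Type u) [Field k] [AddCommGroup V] [Module k V] where
  /-- the underlying set -/
  carrier : Type u
  [addCommGroup : AddCommGroup carrier]
  [moduleBase : Module k carrier]
  [moduleExt : Module (ExteriorAlgebra k V)ᵐᵒᵖ carrier]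
  [scalarTower : IsScalarTower k (ExteriorAlgebra k V)ᵐᵒᵖ carrier]
  [finite : Module.Finite (ExteriorAlgebra k V)ᵐᵒᵖ carrier]
  /-- the homogeneous component of each degree -/
  gr : ℤ → Submodule k carrier
  isInternal : DirectSum.IsInternal gr
  smul_mem : ∀ (i : ℕ) (j : ℤ) (r : ExteriorAlgebra k V) (x : carrier),
    r ∈ ⋀[k]^i V → x ∈ gr j → MulOpposite.op r • x ∈ gr (j + i)

attribute [instance] GrMod.addCommGroup GrMod.moduleBase GrMod.moduleExt GrMod.scalarTower
  GrMod.finite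

variable {k V : Type u} [Field k] [AddCommGroup V] [Module k V]

/-- The space of homomorphisms of degree zero between two graded modules. -/
def homZero (X Y : GrMod k V) :
    Submodule k (X.carrier →ₗ[(ExteriorAlgebra k V)ᵐᵒᵖ] Y.carrier) where
  carrier := {f | ∀ j : ℤ, ∀ x ∈ X.gr j, f x ∈ Y.gr j}
  add_mem' hf hg j x hx := (Y.gr j).add_mem (hf j x hx) (hg j x hx)
  zero_mem' j _ _ := (Y.gr j).zero_mem
  smul_mem' c _ hf j x hx := (Y.gr j).smul_mem c (hf j x hx)

/-- The category `mod R` of finitely generated graded `R`-modules and homomorphisms of degree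
zero. -/
instance : Category (GrMod k V) where
  Hom X Y := homZero X Y
  id X := ⟨LinearMap.id, fun _ _ hx => hx⟩
  comp f g := ⟨g.1.comp f.1, fun j x hx => g.2 j _ (f.2 j x hx)⟩

instance : Preadditive (GrMod k V) where
  homGroup X Y := inferInstanceAs (AddCommGroup (homZero X Y))
  add_comp _ _ _ f f' g := Subtype.ext (LinearMap.comp_add f.1 f'.1 g.1)
  comp_add _ _ _ f g g' := Subtype.ext (LinearMap.add_comp f.1 g'.1 g.1)

instance : Linear k (GrMod k V) where
  homModule X Y := inferInstanceAs (Module k (homZero X Y))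
  smul_comp _ _ _ c f g := Subtype.ext <| LinearMap.ext fun x =>
    (g.1.restrictScalars k).map_smul c (f.1 x)
  comp_smul _ _ _ _ _ _ := rfl

/-- A submodule of a graded module is homogeneous if it is the sum of its homogeneous parts. -/
def IsHomogeneous (X : GrMod k V) (N : Submodule (ExteriorAlgebra k V)ᵐᵒᵖ X.carrier) : Prop :=
  N.restrictScalars k ≤ ⨆ j : ℤ, X.gr j ⊓ N.restrictScalars k

/-- For homogeneous submodules `A ≤ B` of `X`, the subquotient `B / A` with the induced grading is
isomorphic to `M` as a graded module (by an isomorphism of degree zero). -/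
def SubquotientIso (X M : GrMod k V)
    (A B : Submodule (ExteriorAlgebra k V)ᵐᵒᵖ X.carrier) : Prop :=
  ∃ e : (↥B ⧸ A.submoduleOf B) ≃ₗ[(ExteriorAlgebra k V)ᵐᵒᵖ] M.carrier,
    ∀ (j : ℤ) (b : B), (b : X.carrier) ∈ X.gr j → e (Submodule.Quotient.mk b) ∈ M.gr j

/-- `X` belongs to `F(M)`: it has a finite filtration `0 = F₀ ⊆ F₁ ⊆ ⋯ ⊆ Fₜ = X` by homogeneous
submodules all of whose factors `Fᵢ₊₁ / Fᵢ` are isomorphic to `M`. -/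
def filteredBy (M : GrMod k V) : ObjectProperty (GrMod k V) := fun X =>
  ∃ (t : ℕ) (F : ℕ → Submodule (ExteriorAlgebra k V)ᵐᵒᵖ X.carrier),
    F 0 = ⊥ ∧ F t = ⊤ ∧ (∀ i ≤ t, IsHomogeneous X (F i)) ∧
      ∀ i < t, F i ≤ F (i + 1) ∧ SubquotientIso X M (F i) (F (i + 1))

/-- The right ideal `⟨ξ⟩` of the exterior algebra generated by `ξ ∈ V` (it is two-sided, as `ξ`
commutes up to sign with all homogeneous elements). -/
def idealSpan (ξ : V) : Submodule (ExteriorAlgebra k V)ᵐᵒᵖ (ExteriorAlgebra k V) :=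
  Submodule.span _ {ExteriorAlgebra.ι k ξ}

variable (k V) in
/-- The grading of the exterior algebra, with indices in `ℤ`. -/
def extGr (j : ℤ) : Submodule k (ExteriorAlgebra k V) :=
  if 0 ≤ j then ⋀[k]^(j.toNat) V else ⊥

/-- The grading of `R / ⟨ξ⟩` induced by the one of `R`. -/
def cyclicGr (ξ : V) (j : ℤ) : Submodule k (ExteriorAlgebra k V ⧸ idealSpan (k := k) ξ) :=
  (extGr k V j).map ((idealSpan (k := k) ξ).mkQ.restrictScalars k)

/-- The projection of the exterior algebra to its component of degree `i`. -/
def extProj (i : ℕ) : ExteriorAlgebra k V →ₗ[k] ExteriorAlgebra k V :=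
  GradedAlgebra.proj (fun i : ℕ => ⋀[k]^i V) i

theorem extProj_mem_idealSpan (ξ : V) (i : ℕ) (r : ExteriorAlgebra k V)
    (hr : r ∈ idealSpan (k := k) ξ) : extProj i r ∈ idealSpan (k := k) ξ := by
  obtain ⟨a, rfl⟩ := Submodule.mem_span_singleton.1 hr
  have hξ : ExteriorAlgebra.ι k ξ ∈ ⋀[k]^1 V := by
    simpa only [pow_one] using LinearMap.mem_range_self (ExteriorAlgebra.ι k) ξ
  have h := DirectSum.coe_decompose_mul_of_left_mem (fun i : ℕ => ⋀[k]^i V)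
    (a := ExteriorAlgebra.ι k ξ) (b := a.unop) (i := 1) i hξ
  have : extProj (k := k) (V := V) i (a • ExteriorAlgebra.ι k ξ) = _ := h
  rw [this]
  split_ifs
  · exact (idealSpan (k := k) ξ).smul_mem (MulOpposite.op _) (Submodule.mem_span_singleton_self _)
  · exact Submodule.zero_mem _

theorem cyclicGr_isInternal (ξ : V) : DirectSum.IsInternal (cyclicGr (k := k) ξ) := by
  rw [DirectSum.isInternal_submodule_iff_iSupIndep_and_iSup_eq_top]
  constructor
  · -- independence, by means of the induced projections of the quotient
    have key : ∀ i : ℕ, ∃ p : (ExteriorAlgebra k V ⧸ idealSpan (k := k) ξ) →ₗ[k]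
        (ExteriorAlgebra k V ⧸ idealSpan (k := k) ξ),
        ∀ r, p (Submodule.Quotient.mk r) = Submodule.Quotient.mk (extProj i r) := by
      intro i
      refine ⟨((idealSpan (k := k) ξ).restrictScalars k).mapQ
        ((idealSpan (k := k) ξ).restrictScalars k) (extProj i)
        (fun r hr => extProj_mem_idealSpan ξ i r hr), fun r => rfl⟩
    choose p hp using key
    rw [iSupIndep_def]
    intro j
    rw [Submodule.disjoint_def]
    intro x hx hx'
    by_cases hj : 0 ≤ j
    · have h1 : p j.toNat x = x := by
        obtain ⟨r, hr, rfl⟩ := hx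
        rw [SetLike.mem_coe, extGr, if_pos hj] at hr
        change p _ (Submodule.Quotient.mk r) = Submodule.Quotient.mk r
        rw [hp]
        congr 1
        exact DirectSum.decompose_of_mem_same (fun i : ℕ => ⋀[k]^i V) hr
      have h2 : (⨆ (i) (_ : i ≠ j), cyclicGr (k := k) ξ i) ≤ LinearMap.ker (p j.toNat) := by
        refine iSup₂_le fun i hi => ?_
        rintro _ ⟨r, hr, rfl⟩
        rw [SetLike.mem_coe, extGr] at hr
        split_ifs at hr with hi0
        · rw [LinearMap.mem_ker]
          change p _ (Submodule.Quotient.mk r) = 0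
          rw [hp]
          have : extProj j.toNat r = 0 :=
            DirectSum.decompose_of_mem_ne (fun i : ℕ => ⋀[k]^i V) hr (by omega)
          rw [this]; rfl
        · rw [(Submodule.mem_bot k).1 hr, map_zero]
          exact Submodule.zero_mem _
      rw [← h1]
      exact h2 hx'
    · obtain ⟨r, hr, rfl⟩ := hx
      rw [SetLike.mem_coe, extGr, if_neg hj] at hr
      rw [(Submodule.mem_bot k).1 hr, map_zero]
  · rw [eq_top_iff]
    rintro x -
    obtain ⟨r, rfl⟩ := Submodule.Quotient.mk_surjective _ x
    induction r using DirectSum.Decomposition.inductionOn (fun i : ℕ => ⋀[k]^i V) with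
    | zero => exact Submodule.zero_mem _
    | add a b ha hb => exact Submodule.add_mem _ ha hb
    | @homogeneous i m =>
      refine Submodule.mem_iSup_of_mem (i : ℤ) ⟨m, ?_, rfl⟩
      rw [SetLike.mem_coe, extGr, if_pos (Int.natCast_nonneg i), Int.toNat_natCast]
      exact m.2

/-- The cyclic graded module `M_ξ = R / ⟨ξ⟩`, generated in degree zero. -/
def cyclicMod (ξ : V) : GrMod k V where
  carrier := ExteriorAlgebra k V ⧸ idealSpan (k := k) ξ
  finite :=
    have : Module.Finite (ExteriorAlgebra k V)ᵐᵒᵖ (ExteriorAlgebra k V) :=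
      ⟨⟨{1}, by
        rw [Finset.coe_singleton, eq_top_iff]
        intro x _
        exact Submodule.mem_span_singleton.2 ⟨MulOpposite.op x, one_mul x⟩⟩⟩
    inferInstance
  gr := cyclicGr ξ
  isInternal := cyclicGr_isInternal ξ
  smul_mem := by
    rintro i j r _ hr ⟨x, hx, rfl⟩
    refine ⟨x * r, ?_, rfl⟩
    rw [SetLike.mem_coe, extGr] at hx ⊢
    split_ifs at hx with hj
    · rw [if_pos (by omega)]
      have h := SetLike.mul_mem_graded (A := fun i : ℕ => ⋀[k]^i V) hx hr
      have e : (j + i).toNat = j.toNat + i := by omega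
      rw [e]
      exact h
    · rw [(Submodule.mem_bot k).1 hx, zero_mul]
      exact Submodule.zero_mem _

end ExteriorGraded

open scoped ModuleCat in
/-- The modules over the power series ring `k[[t₁, …, tₙ]]` which are finite dimensional
over `k`. -/
def finDimPowerSeriesModule (k : Type u) [Field k] (n : ℕ) :
    ObjectProperty (ModuleCat.{u} (MvPowerSeries (Fin n) k)) :=
  fun N => Module.Finite k N

end

/-! Choose a complement of `k ξ` in `V` and identify it with `k ^ n`; put `S = ⋀ (k ^ n)`. As an
`S`-module, `R / ⟨ξ⟩` is free on one generator of degree zero, so a module `X` in `F(M)` is free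
over `S` on lifts of the generators of its factors, all in degree zero: `X = X₀ ⊗ S`. What remains
is the action of `ξ`. Since `ξ` kills the generator of each factor, it acts on these lifts strictly
triangularly.

The map `ξ : X₀ → X₁ = X₀ ⊗ k ^ n` amounts to `n` endomorphisms `A i` of `X₀`, with `y ξ = ∑ (A i y)
eᵢ`. Because `ξ` anticommutes with `k ^ n`, the `A i` determine `ξ` on all of `X`. The relation `ξ²
= 0` reads `∑ (A i (A j y)) eᵢ eⱼ = 0`, which says exactly that the `A i` commute; triangularity
makes them nilpotent. Hence `X₀` is a finite dimensional module over the power series ring. Degree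
zero maps `X → Y` are the `k`-linear maps `X₀ → Y₀` commuting with the `A i`, so `X ↦ X₀` is fully
faithful (`IsFrame.map_isComponents`, `IsFrame.exists_extension`, `IsFrame.hom_ext`).

Conversely, by Nakayama a finite dimensional module has a basis in which the variables are strictly
triangular (`exists_basis_X_smul_mem_span`). Their matrices define an action of `ξ` on a free
`S`-module, and the triangular shape supplies the filtration (`filteredBy_freeMod`), giving
essential surjectivity. -/

namespace MvPowerSeries

/-! ### Finite dimensional modules over the power series ring -/

variable {k : Type u} [Field k] {n : ℕ}

/-- Each nonconstant monomial is assigned to the least variable occurring in it. This decomposition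
allows inductions along a triangular basis to replace continuity arguments. -/
theorem exists_eq_C_add_sum_X_mul (s : MvPowerSeries (Fin n) k) :
    ∃ (c : k) (g : Fin n → MvPowerSeries (Fin n) k), s = C c + ∑ i, X i * g i := by
  classical
  let φ : Fin n → MvPowerSeries (Fin n) k := fun i d =>
    if d i ≠ 0 ∧ ∀ j < i, d j = 0 then coeff d s else 0
  have hdvd : ∀ i : Fin n, (X i : MvPowerSeries (Fin n) k) ∣ φ i := fun i =>
    X_dvd_iff.2 fun m hm => if_neg fun h => h.1 hm
  choose g hg using hdvd
  refine ⟨constantCoeff s, g, ?_⟩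
  ext d
  rw [map_add, map_sum, coeff_C]
  have hc : ∀ i, coeff d (X i * g i) =
      if d i ≠ 0 ∧ ∀ j < i, d j = 0 then coeff d s else 0 := fun i => by
    rw [← hg i]; rfl
  simp only [hc]
  by_cases hd : d = 0
  · simp [hd]
  · rw [if_neg hd, zero_add]
    have hne : (Finset.univ.filter fun i => d i ≠ 0).Nonempty := by
      by_contra h
      rw [Finset.not_nonempty_iff_eq_empty, Finset.filter_eq_empty_iff] at h
      exact hd (Finsupp.ext fun i => not_not.1 (h (Finset.mem_univ i)))
    have hmin := Finset.min'_mem _ hne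
    set i₀ := Finset.min' _ hne
    have hlt : ∀ j < i₀, d j = 0 := fun j hj => by
      by_contra h
      exact absurd (Finset.min'_le _ j (by simpa using h)) (not_le.2 hj)
    rw [Finset.sum_eq_single i₀]
    · rw [if_pos ⟨(Finset.mem_filter.1 hmin).2, hlt⟩]
    · intro i _ hi
      refine if_neg fun h => ?_
      rcases lt_or_gt_of_ne hi with h' | h'
      · exact h.1 (hlt i h')
      · exact (Finset.mem_filter.1 hmin).2 (h.2 i₀ h')
    · simp

theorem X_mem_maximalIdeal (i : Fin n) :
    (X i : MvPowerSeries (Fin n) k) ∈ IsLocalRing.maximalIdeal (MvPowerSeries (Fin n) k) := by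
  rw [IsLocalRing.mem_maximalIdeal, mem_nonunits_iff, isUnit_iff_constantCoeff]
  simp

/-- A module over the power series ring which is finite dimensional over `k` has a basis in which
the variables act by strictly triangular matrices. -/
theorem exists_basis_X_smul_mem_span (d : ℕ) :
    ∀ (N : Type u) [AddCommGroup N] [Module k N] [Module (MvPowerSeries (Fin n) k) N]
      [IsScalarTower k (MvPowerSeries (Fin n) k) N] [Module.Finite k N],
      Module.finrank k N = d → ∃ b : Module.Basis (Fin d) k N, ∀ i j,
        (X i : MvPowerSeries (Fin n) k) • b j ∈ Submodule.span k (b '' {l | l < j}) := by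
  induction d with
  | zero =>
    intro N _ _ _ _ _ h
    have := Module.finrank_zero_iff.1 h
    exact ⟨Module.Basis.empty N, fun i j => j.elim0⟩
  | succ d ih =>
    intro N _ _ _ _ _ h
    have hfin : Module.Finite (MvPowerSeries (Fin n) k) N := Module.Finite.of_restrictScalars_finite k _ N
    have hnt : Nontrivial N := Module.nontrivial_of_finrank_pos (R := k) (by omega)
    -- Nakayama's lemma. A maximal submodule `H` containing `𝔪 N` then has codimension one over `k`,
    -- because power series act on `N / H` through their constant terms.
    have hne : IsLocalRing.maximalIdeal (MvPowerSeries (Fin n) k) •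
        (⊤ : Submodule (MvPowerSeries (Fin n) k) N) ≠ ⊤ := by
      intro h
      have := Submodule.eq_bot_of_le_smul_of_le_jacobson_bot _ _ hfin.fg_top h.ge
        (IsLocalRing.maximalIdeal_le_jacobson _)
      exact top_ne_bot this
    obtain ⟨H, hH, hle⟩ := (eq_top_or_exists_le_coatom _).resolve_left hne
    have hX : ∀ (i : Fin n) (y : N), (X i : MvPowerSeries (Fin n) k) • y ∈ H := fun i y =>
      hle (Submodule.smul_mem_smul (X_mem_maximalIdeal i) trivial)
    obtain ⟨y, hy⟩ : ∃ y, y ∉ H := by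
      by_contra! hall
      exact hH.1 (eq_top_iff.2 fun x _ => hall x)
    have hsp : ∀ z : N, ∃ c : k, z + c • y ∈ H.restrictScalars k := by
      intro z
      have hz : z ∈ H ⊔ Submodule.span (MvPowerSeries (Fin n) k) {y} := by
        rw [hH.2 _ (left_lt_sup.2 fun hh => hy (hh (Submodule.mem_span_singleton_self y)))]
        trivial
      obtain ⟨x, hx, w, hw, rfl⟩ := Submodule.mem_sup.1 hz
      obtain ⟨s, rfl⟩ := Submodule.mem_span_singleton.1 hw
      obtain ⟨c, g, rfl⟩ := exists_eq_C_add_sum_X_mul s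
      refine ⟨-c, ?_⟩
      have hc : (C c : MvPowerSeries (Fin n) k) • y = c • y :=
        algebraMap_smul (MvPowerSeries (Fin n) k) c y
      rw [add_smul, hc, neg_smul]
      have : x + (c • y + (∑ i, X i * g i) • y) + -(c • y) = x + (∑ i, X i * g i) • y := by abel
      rw [this]
      refine H.add_mem hx ?_
      rw [Finset.sum_smul]
      exact H.sum_mem fun i _ => by rw [mul_smul]; exact hX i _
    have hli : ∀ (c : k), ∀ x ∈ H.restrictScalars k, c • y + x = 0 → c = 0 := by
      intro c x hx h0
      by_contra hc
      refine hy ?_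
      have h1 : c • y ∈ H.restrictScalars k := by
        rw [eq_neg_of_add_eq_zero_left h0]; exact neg_mem hx
      exact (Submodule.smul_mem_iff (H.restrictScalars k) hc).1 h1
    have hrank : Module.finrank k H = d := by
      have h1 := Module.finrank_eq_card_basis
        (Module.Basis.mkFinSnoc (Module.finBasis k (H.restrictScalars k)) y hli hsp)
      rw [h, Fintype.card_fin] at h1
      exact (Nat.succ_injective h1).symm
    have : Module.Finite k H := inferInstanceAs (Module.Finite k (H.restrictScalars k))
    obtain ⟨b, hb⟩ := ih H hrank
    let b' : Module.Basis (Fin d) k (H.restrictScalars k) := b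
    -- The new vector `y` comes last: the variables send all of `N` into `H`, the span of the
    -- earlier vectors.
    let B := Module.Basis.mkFinSnoc b' y hli hsp
    have hB : ∀ j : Fin d, B j.castSucc = b j := fun j => by
      simp only [B, Module.Basis.coe_mkFinSnoc, Fin.snoc_castSucc]
      rfl
    refine ⟨B, fun i j => ?_⟩
    refine Fin.lastCases ?_ (fun j => ?_) j
    · have h1 : (⟨X i • B (Fin.last d), hX i _⟩ : H) ∈ Submodule.span k (Set.range b) :=
        b.mem_span _
      have h2 := Submodule.mem_map_of_mem (f := H.subtype.restrictScalars k) h1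
      rw [Submodule.map_span, ← Set.range_comp] at h2
      refine Submodule.span_mono ?_ h2
      rintro _ ⟨l, rfl⟩
      exact ⟨l.castSucc, Fin.castSucc_lt_last l, hB l⟩
    · have h2 := Submodule.mem_map_of_mem (f := H.subtype.restrictScalars k) (hb i j)
      rw [Submodule.map_span, ← Set.image_comp] at h2
      rw [hB]
      refine Submodule.span_mono ?_ h2
      rintro _ ⟨l, hl, rfl⟩
      exact ⟨l.castSucc, Fin.castSucc_lt_castSucc_iff.2 hl, hB l⟩

/-- A `k`-linear map between modules over the power series ring that commutes with the variables is
linear over the power series ring, if the source is finite dimensional over `k`. -/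
theorem map_smul_of_map_X_smul {N N' : Type u} [AddCommGroup N] [Module k N]
    [Module (MvPowerSeries (Fin n) k) N] [IsScalarTower k (MvPowerSeries (Fin n) k) N]
    [Module.Finite k N] [AddCommGroup N'] [Module k N'] [Module (MvPowerSeries (Fin n) k) N']
    [IsScalarTower k (MvPowerSeries (Fin n) k) N'] (f : N →ₗ[k] N')
    (hf : ∀ i y, f ((X i : MvPowerSeries (Fin n) k) • y) = (X i : MvPowerSeries (Fin n) k) • f y)
    (s : MvPowerSeries (Fin n) k) (y : N) : f (s • y) = s • f y := by
  obtain ⟨b, hb⟩ := exists_basis_X_smul_mem_span (k := k) (n := n) _ N rfl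
  let T (s : MvPowerSeries (Fin n) k) : Submodule k N :=
    { carrier := {y | f (s • y) = s • f y}
      add_mem' := fun {x y} hx hy => by
        simp only [Set.mem_ofPred_eq] at *
        rw [smul_add, map_add, hx, hy, map_add, smul_add]
      zero_mem' := by simp
      smul_mem' := fun c x hx => by
        simp only [Set.mem_ofPred_eq] at *
        rw [smul_comm, map_smul, hx, map_smul, smul_comm] }
  -- The series `s` stays universally quantified: the step for `C c + ∑ X i * g i` uses the
  -- hypothesis for `g i` on the vectors preceding `b j`.
  have key : ∀ j, ∀ s, b j ∈ T s := by
    intro j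
    induction j using WellFoundedLT.induction with
    | ind j ih =>
      intro s
      obtain ⟨c, g, rfl⟩ := exists_eq_C_add_sum_X_mul s
      have hc : ∀ y : N, (C c : MvPowerSeries (Fin n) k) • y = c • y := fun y =>
        algebraMap_smul (MvPowerSeries (Fin n) k) c y
      have hc' : ∀ y : N', (C c : MvPowerSeries (Fin n) k) • y = c • y := fun y =>
        algebraMap_smul (MvPowerSeries (Fin n) k) c y
      change f (_ • b j) = _ • f (b j)
      rw [add_smul, add_smul, map_add, hc, hc', map_smul, Finset.sum_smul, Finset.sum_smul, map_sum]
      congr 1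
      refine Finset.sum_congr rfl fun i _ => ?_
      rw [mul_comm, mul_smul, mul_smul, ← hf]
      have : (X i : MvPowerSeries (Fin n) k) • b j ∈ T (g i) := by
        refine Submodule.span_le.2 ?_ (hb i j)
        rintro _ ⟨l, hl, rfl⟩
        exact ih l hl _
      exact this
  have : (⊤ : Submodule k N) ≤ T s := by
    rw [← b.span_eq, Submodule.span_le]
    rintro _ ⟨j, rfl⟩
    exact key j s
  exact this trivial

/-- Evaluation of power series at commuting nilpotent endomorphisms. -/
theorem exists_algHom_X_eq {N : Type u} [AddCommGroup N] [Module k N]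
    (A : Fin n → Module.End k N) (hc : ∀ i j, A i * A j = A j * A i)
    (hn : ∀ i, IsNilpotent (A i)) :
    ∃ f : MvPowerSeries (Fin n) k →ₐ[k] Module.End k N, ∀ i, f (X i) = A i := by
  let _ : CommRing (Algebra.adjoin k (Set.range A)) :=
    { (inferInstance : Ring (Algebra.adjoin k (Set.range A))) with
      mul_comm := (Algebra.isMulCommutative_adjoin k (s := Set.range A)
        (by rintro _ ⟨i, rfl⟩ _ ⟨j, rfl⟩; exact hc i j)).is_comm.comm }
  let a : Fin n → Algebra.adjoin k (Set.range A) := fun i =>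
    ⟨A i, Algebra.subset_adjoin ⟨i, rfl⟩⟩
  have ha : ∀ i, IsNilpotent (a i) := fun i => by
    obtain ⟨m, hm⟩ := hn i
    exact ⟨m, Subtype.ext hm⟩
  -- Evaluation is expressed as substitution of nilpotent constants into power series in no
  -- variables, followed by the constant coefficient. The target must be commutative, hence the
  -- subalgebra generated by the `A i`.
  have hs : HasSubst fun i => (C (a i) : MvPowerSeries (Fin 0) (Algebra.adjoin k (Set.range A))) :=
    hasSubst_of_constantCoeff_nilpotent fun i => by simpa using ha i
  let f₁ : MvPowerSeries (Fin n) k →+* Algebra.adjoin k (Set.range A) :=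
    (constantCoeff (σ := Fin 0)).comp (substAlgHom (R := k) hs).toRingHom
  have h₁ : ∀ c : k, f₁ (algebraMap k _ c) = algebraMap k _ c := fun c => by
    change constantCoeff (substAlgHom (R := k) hs (algebraMap k _ c)) = _
    rw [AlgHom.commutes, MvPowerSeries.algebraMap_apply, constantCoeff_C]
  refine ⟨(Subalgebra.val _).comp (⟨f₁, h₁⟩ : MvPowerSeries (Fin n) k →ₐ[k] _), fun i => ?_⟩
  change ((constantCoeff (substAlgHom (R := k) hs (X i)) : Algebra.adjoin k (Set.range A)) :
    Module.End k N) = A i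
  rw [substAlgHom_X, constantCoeff_C]

end MvPowerSeries

namespace ExteriorGraded

/-! ### Exterior algebras and a splitting of `V` -/

section Exterior

variable {k V : Type u} [Field k] [AddCommGroup V] [Module k V] {n : ℕ}

theorem extGr_natCast (i : ℕ) : extGr k V i = ⋀[k]^i V := by
  rw [extGr, if_pos (Int.natCast_nonneg i), Int.toNat_natCast]

theorem extGr_of_neg {j : ℤ} (hj : j < 0) : extGr k V j = ⊥ := if_neg (not_le.2 hj)

theorem mul_mem_extGr {j : ℤ} {i : ℕ} {a b : ExteriorAlgebra k V} (ha : a ∈ extGr k V j)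
    (hb : b ∈ ⋀[k]^i V) : a * b ∈ extGr k V (j + i) := by
  rcases lt_or_ge j 0 with hj | hj
  · rw [extGr_of_neg hj, Submodule.mem_bot] at ha
    rw [ha, zero_mul]
    exact Submodule.zero_mem _
  · lift j to ℕ using hj
    rw [extGr_natCast] at ha
    rw [← Nat.cast_add, extGr_natCast]
    exact SetLike.mul_mem_graded (A := fun i : ℕ => ⋀[k]^i V) ha hb

theorem ι_mem_exteriorPower_one (v : V) : ExteriorAlgebra.ι k v ∈ ⋀[k]^1 V := by
  simpa only [pow_one] using LinearMap.mem_range_self (ExteriorAlgebra.ι k) v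

theorem one_mem_extGr_zero : (1 : ExteriorAlgebra k V) ∈ extGr k V 0 := by
  rw [← Nat.cast_zero, extGr_natCast]
  exact SetLike.one_mem_graded (fun i : ℕ => ⋀[k]^i V)

theorem extProj_of_mem {i : ℕ} {r : ExteriorAlgebra k V} (hr : r ∈ ⋀[k]^i V) :
    extProj i r = r :=
  DirectSum.decompose_of_mem_same (fun i : ℕ => ⋀[k]^i V) hr

theorem extProj_of_mem_ne {i j : ℕ} {r : ExteriorAlgebra k V} (hr : r ∈ ⋀[k]^i V) (h : i ≠ j) :
    extProj j r = 0 :=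
  DirectSum.decompose_of_mem_ne (fun i : ℕ => ⋀[k]^i V) hr h

theorem extProj_mem (i : ℕ) (r : ExteriorAlgebra k V) : extProj i r ∈ ⋀[k]^i V :=
  (DirectSum.decompose (fun i : ℕ => ⋀[k]^i V) r i).2

theorem map_mem_exteriorPower {W : Type u} [AddCommGroup W] [Module k W] (f : V →ₗ[k] W) {i : ℕ}
    {r : ExteriorAlgebra k V} (hr : r ∈ ⋀[k]^i V) : ExteriorAlgebra.map f r ∈ ⋀[k]^i W := by
  have h := Submodule.mem_map_of_mem (f := (ExteriorAlgebra.map f).toLinearMap) hr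
  rw [ExteriorAlgebra.exteriorPower, Submodule.map_pow, ExteriorAlgebra.ι_range_map_map] at h
  exact pow_le_pow_left' (show _ ≤ LinearMap.range (ExteriorAlgebra.ι k) by
    rintro _ ⟨x, -, rfl⟩; exact ⟨x, rfl⟩) i h

theorem map_mem_extGr {W : Type u} [AddCommGroup W] [Module k W] (f : V →ₗ[k] W) {j : ℤ}
    {r : ExteriorAlgebra k V} (hr : r ∈ extGr k V j) : ExteriorAlgebra.map f r ∈ extGr k W j := by
  rw [extGr] at hr ⊢
  split_ifs at hr ⊢
  · exact map_mem_exteriorPower f hr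
  · rw [(Submodule.mem_bot k).1 hr, map_zero]
    exact Submodule.zero_mem _

theorem exists_eq_algebraMap {r : ExteriorAlgebra k V} (hr : r ∈ ⋀[k]^0 V) :
    ∃ c : k, algebraMap k _ c = r := by
  rw [ExteriorAlgebra.exteriorPower, pow_zero] at hr
  exact Submodule.mem_one.1 hr

theorem exists_eq_ι {r : ExteriorAlgebra k V} (hr : r ∈ ⋀[k]^1 V) :
    ∃ v : V, ExteriorAlgebra.ι k v = r := by
  rw [ExteriorAlgebra.exteriorPower, pow_one] at hr
  exact hr

theorem ι_mul_mem_idealSpan (ξ v : V) {r : ExteriorAlgebra k V} (hr : r ∈ idealSpan (k := k) ξ) :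
    ExteriorAlgebra.ι k v * r ∈ idealSpan (k := k) ξ := by
  obtain ⟨a, rfl⟩ := Submodule.mem_span_singleton.1 hr
  refine Submodule.mem_span_singleton.2 ⟨-MulOpposite.op (ExteriorAlgebra.ι k v * a.unop), ?_⟩
  have h := eq_neg_of_add_eq_zero_left (ExteriorAlgebra.ι_add_mul_swap (R := k) v ξ)
  change ExteriorAlgebra.ι k ξ * -(ExteriorAlgebra.ι k v * a.unop) =
    ExteriorAlgebra.ι k v * (ExteriorAlgebra.ι k ξ * a.unop)
  rw [← mul_assoc, h, mul_neg, neg_mul, mul_assoc]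

theorem mul_mem_idealSpan (ξ : V) (s : ExteriorAlgebra k V) {r : ExteriorAlgebra k V}
    (hr : r ∈ idealSpan (k := k) ξ) : s * r ∈ idealSpan (k := k) ξ := by
  induction s using ExteriorAlgebra.induction generalizing r with
  | algebraMap c =>
    rw [Algebra.commutes]
    exact (idealSpan (k := k) ξ).smul_mem (MulOpposite.op _) hr
  | ι v => exact ι_mul_mem_idealSpan ξ v hr
  | mul a b ha hb => rw [mul_assoc]; exact ha (hb hr)
  | add a b ha hb => rw [add_mul]; exact Submodule.add_mem _ (ha hr) (hb hr)

variable (k) in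
/-- The standard generators of the exterior algebra of `k ^ n`. -/
def gen (i : Fin n) : ExteriorAlgebra k (Fin n → k) := ExteriorAlgebra.ι k (Pi.single i 1)

theorem ι_eq_sum_gen (u : Fin n → k) : ExteriorAlgebra.ι k u = ∑ i, u i • gen k i := by
  conv_lhs => rw [pi_eq_sum_univ' u]
  rw [map_sum]
  refine Finset.sum_congr rfl fun i _ => ?_
  rw [gen, ← map_smul]

/-- The terms at `(i, l)` and `(l, i)` cancel and the diagonal ones vanish as squares, so the
characteristic plays no role. With the converse below, this turns `ξ² = 0` into commutativity of the
components of `ξ`. -/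
theorem sum_smul_gen_mul_gen_eq_zero (c : Fin n → Fin n → k) (hc : ∀ i l, c i l = c l i) :
    ∑ i, ∑ l, c i l • (gen k i * gen k l) = 0 := by
  rw [← Finset.sum_product']
  refine Finset.sum_involution (fun p _ => p.swap) ?_ ?_ (fun _ _ => Finset.mem_univ _)
    (fun _ _ => Prod.swap_swap _)
  · rintro ⟨i, l⟩ -
    dsimp only [Prod.swap]
    rw [hc l i, ← smul_add, gen, gen, ExteriorAlgebra.ι_add_mul_swap, smul_zero]
  · rintro ⟨i, l⟩ - h h'
    obtain rfl : l = i := congrArg Prod.fst h'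
    exact h (by dsimp only; rw [gen, ExteriorAlgebra.ι_sq_zero, smul_zero])

/-- Contracting the sum with the `p`-th and then the `q`-th coordinate form leaves `c p q - c q p`.
-/
theorem eq_of_sum_smul_gen_mul_gen_eq_zero (c : Fin n → Fin n → k)
    (h : ∑ i, ∑ l, c i l • (gen k i * gen k l) = 0) (p q : Fin n) : c p q = c q p := by
  have h1 := congrArg (fun r : CliffordAlgebra (0 : QuadraticForm k (Fin n → k)) =>
    CliffordAlgebra.contractLeft (LinearMap.proj (R := k) (φ := fun _ => k) q)
      (CliffordAlgebra.contractLeft (LinearMap.proj (R := k) (φ := fun _ => k) p) r)) h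
  have h2 : ∀ i l : Fin n,
      CliffordAlgebra.contractLeft (LinearMap.proj (R := k) (φ := fun _ => k) q)
      (CliffordAlgebra.contractLeft (LinearMap.proj (R := k) (φ := fun _ => k) p)
        (gen k i * gen k l : CliffordAlgebra (0 : QuadraticForm k (Fin n → k)))) =
      algebraMap k _ ((if p = i then 1 else 0) * (if q = l then 1 else 0) -
        (if p = l then 1 else 0) * (if q = i then 1 else 0)) := by
    intro i l
    rw [gen, gen]
    change CliffordAlgebra.contractLeft _ (CliffordAlgebra.contractLeft _
      (CliffordAlgebra.ι _ _ * CliffordAlgebra.ι _ _)) = _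
    rw [CliffordAlgebra.contractLeft_ι_mul, CliffordAlgebra.contractLeft_ι, map_sub, map_smul,
      CliffordAlgebra.contractLeft_ι, CliffordAlgebra.contractLeft_mul_algebraMap,
      CliffordAlgebra.contractLeft_ι]
    simp only [LinearMap.proj_apply, Pi.single_apply, Algebra.smul_def, ← map_mul, ← map_sub]
    congr 1
    ring
  simp only [map_sum, map_smul, h2, map_zero] at h1
  simp only [Algebra.smul_def, ← map_mul, ← map_sum] at h1
  have h3 := (ExteriorAlgebra.algebraMap_eq_zero_iff (R := k) (Fin n → k) _).1 h1
  simpa [mul_sub, Finset.sum_sub_distrib, sub_eq_zero] using h3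

/-- The inclusion of the exterior algebra of `k ^ n` given by a splitting of `V`. -/
def incl (e : V ≃ₗ[k] k × (Fin n → k)) : ExteriorAlgebra k (Fin n → k) →ₐ[k] ExteriorAlgebra k V :=
  ExteriorAlgebra.map (e.symm.toLinearMap ∘ₗ LinearMap.inr k k (Fin n → k))

/-- The projection to the exterior algebra of `k ^ n` given by a splitting of `V`. -/
def proj (e : V ≃ₗ[k] k × (Fin n → k)) : ExteriorAlgebra k V →ₐ[k] ExteriorAlgebra k (Fin n → k) :=
  ExteriorAlgebra.map (LinearMap.snd k k (Fin n → k) ∘ₗ e.toLinearMap)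

variable (e : V ≃ₗ[k] k × (Fin n → k))

@[simp]
theorem incl_ι (u : Fin n → k) :
    incl e (ExteriorAlgebra.ι k u) = ExteriorAlgebra.ι k (e.symm (0, u)) :=
  ExteriorAlgebra.map_apply_ι _ _

@[simp]
theorem proj_ι (v : V) : proj e (ExteriorAlgebra.ι k v) = ExteriorAlgebra.ι k (e v).2 :=
  ExteriorAlgebra.map_apply_ι _ _

@[simp]
theorem proj_incl (r : ExteriorAlgebra k (Fin n → k)) : proj e (incl e r) = r := by
  have : (proj e).comp (incl e) = AlgHom.id k _ := by
    ext
    simp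
  exact DFunLike.congr_fun this r

theorem ι_eq_add {ξ : V} (he : e ξ = (1, 0)) (v : V) : ExteriorAlgebra.ι k v =
    (e v).1 • ExteriorAlgebra.ι k ξ + incl e (ExteriorAlgebra.ι k (e v).2) := by
  rw [incl_ι, ← map_smul, ← map_add]
  congr 1
  apply e.injective
  simp [he]

theorem proj_eq_zero {ξ : V} (he : e ξ = (1, 0)) {r : ExteriorAlgebra k V}
    (hr : r ∈ idealSpan (k := k) ξ) : proj e r = 0 := by
  obtain ⟨a, rfl⟩ := Submodule.mem_span_singleton.1 hr
  change proj e (ExteriorAlgebra.ι k ξ * a.unop) = 0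
  rw [map_mul, proj_ι, he, map_zero, zero_mul]

/-- Together with `proj_eq_zero` this identifies `R / ⟨ξ⟩` with the exterior algebra of `k ^ n`. The
product case needs `⟨ξ⟩` to be two-sided. -/
theorem sub_incl_proj_mem {ξ : V} (he : e ξ = (1, 0)) (r : ExteriorAlgebra k V) :
    r - incl e (proj e r) ∈ idealSpan (k := k) ξ := by
  induction r using ExteriorAlgebra.induction with
  | algebraMap c => simp
  | ι v =>
    rw [proj_ι]
    nth_rw 1 [ι_eq_add e he v]
    rw [add_sub_cancel_right, Algebra.smul_def, Algebra.commutes]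
    exact (idealSpan (k := k) ξ).smul_mem (MulOpposite.op _) (Submodule.mem_span_singleton_self _)
  | mul a b ha hb =>
    have : a * b - incl e (proj e (a * b)) =
        (a - incl e (proj e a)) * b + incl e (proj e a) * (b - incl e (proj e b)) := by
      rw [map_mul, map_mul]
      noncomm_ring
    rw [this]
    exact Submodule.add_mem _ ((idealSpan (k := k) ξ).smul_mem (MulOpposite.op b) ha)
      (mul_mem_idealSpan ξ _ hb)
  | add a b ha hb =>
    rw [map_add, map_add, add_sub_add_comm]
    exact Submodule.add_mem _ ha hb

/-- A family of subspaces admitting projections is the family of components of a grading. -/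
theorem isInternal_of_proj {C : Type u} [AddCommGroup C] [Module k C] (G : ℤ → Submodule k C)
    (P : ℤ → C →ₗ[k] C) (h1 : ∀ j, ∀ x ∈ G j, P j x = x)
    (h2 : ∀ i j, i ≠ j → ∀ x ∈ G i, P j x = 0) (h3 : ⨆ j, G j = ⊤) : DirectSum.IsInternal G := by
  rw [DirectSum.isInternal_submodule_iff_iSupIndep_and_iSup_eq_top]
  refine ⟨?_, h3⟩
  rw [iSupIndep_def]
  intro j
  rw [Submodule.disjoint_def]
  intro x hx hx'
  have h : (⨆ (i) (_ : i ≠ j), G i) ≤ LinearMap.ker (P j) :=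
    iSup₂_le fun i hi y hy => h2 i j hi y hy
  rw [← h1 j x hx]
  exact h hx'

end Exterior

end ExteriorGraded

namespace ExteriorGraded

/-! ### Projections to homogeneous components -/

section Grading

variable {k V : Type u} [Field k] [AddCommGroup V] [Module k V]

/-- The projection of the exterior algebra to its component of integral degree `j`. -/
noncomputable def extProjInt (j : ℤ) : ExteriorAlgebra k V →ₗ[k] ExteriorAlgebra k V :=
  if 0 ≤ j then extProj j.toNat else 0

theorem extProjInt_mem (j : ℤ) (r : ExteriorAlgebra k V) : extProjInt j r ∈ extGr k V j := by
  rw [extProjInt, extGr]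
  split_ifs
  · exact extProj_mem _ r
  · exact Submodule.zero_mem _

theorem extProjInt_of_mem {j : ℤ} {r : ExteriorAlgebra k V} (hr : r ∈ extGr k V j) :
    extProjInt j r = r := by
  rw [extProjInt]
  rw [extGr] at hr
  split_ifs at hr ⊢
  · exact extProj_of_mem hr
  · rw [(Submodule.mem_bot k).1 hr, map_zero]

theorem extProjInt_of_mem_ne {i j : ℤ} {r : ExteriorAlgebra k V} (hr : r ∈ extGr k V i)
    (h : i ≠ j) : extProjInt j r = 0 := by
  rw [extProjInt]
  rw [extGr] at hr
  split_ifs at hr ⊢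
  · exact extProj_of_mem_ne hr (by omega)
  · rw [(Submodule.mem_bot k).1 hr, map_zero]
  · rfl
  · rfl

theorem extGr_induction {p : ExteriorAlgebra k V → Prop} (h0 : p 0)
    (hadd : ∀ a b, p a → p b → p (a + b)) (h : ∀ (j : ℤ), ∀ r ∈ extGr k V j, p r)
    (r : ExteriorAlgebra k V) : p r := by
  induction r using DirectSum.Decomposition.inductionOn (fun i : ℕ => ⋀[k]^i V) with
  | zero => exact h0
  | add a b ha hb => exact hadd a b ha hb
  | @homogeneous i m => exact h i m (by rw [extGr_natCast]; exact m.2)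

namespace GrMod

variable (X : GrMod k V)

/-- The projection of a graded module to its component of degree `j`. -/
noncomputable def grProj (j : ℤ) : X.carrier →ₗ[k] X.carrier :=
  (X.gr j).subtype ∘ₗ DirectSum.component k ℤ (fun i => X.gr i) j ∘ₗ
    (LinearEquiv.ofBijective (DirectSum.coeLinearMap X.gr) X.isInternal).symm.toLinearMap

variable {X}

theorem ofBijective_symm_apply {i : ℤ} {x : X.carrier} (hx : x ∈ X.gr i) :
    (LinearEquiv.ofBijective (DirectSum.coeLinearMap X.gr) X.isInternal).symm x =
      DirectSum.lof k ℤ (fun i => X.gr i) i ⟨x, hx⟩ := by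
  rw [LinearEquiv.symm_apply_eq]
  exact (DirectSum.coeLinearMap_lof X.gr i ⟨x, hx⟩).symm

theorem grProj_of_mem {j : ℤ} {x : X.carrier} (hx : x ∈ X.gr j) : X.grProj j x = x := by
  simp only [grProj, LinearMap.comp_apply, LinearEquiv.coe_coe, ofBijective_symm_apply hx]
  rw [DirectSum.component.lof_self]
  rfl

theorem grProj_of_mem_ne {i j : ℤ} {x : X.carrier} (hx : x ∈ X.gr i) (h : i ≠ j) :
    X.grProj j x = 0 := by
  simp only [grProj, LinearMap.comp_apply, LinearEquiv.coe_coe, ofBijective_symm_apply hx]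
  rw [DirectSum.component.of, dif_neg h]
  rfl

theorem op_algebraMap_smul (c : k) (x : X.carrier) :
    MulOpposite.op (algebraMap k (ExteriorAlgebra k V) c) • x = c • x :=
  algebraMap_smul (ExteriorAlgebra k V)ᵐᵒᵖ c x

theorem smul_mem_of_mem_extGr {j : ℤ} {r : ExteriorAlgebra k V} {x : X.carrier}
    (hr : r ∈ extGr k V j) (hx : x ∈ X.gr 0) : MulOpposite.op r • x ∈ X.gr j := by
  rcases lt_or_ge j 0 with hj | hj
  · rw [extGr_of_neg hj, Submodule.mem_bot] at hr
    rw [hr, MulOpposite.op_zero, zero_smul]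
    exact Submodule.zero_mem _
  · lift j to ℕ using hj
    rw [extGr_natCast] at hr
    simpa using X.smul_mem j 0 r x hr hx

end GrMod

end Grading

/-! ### Homogeneous frames of filtered modules -/

section Filtered

variable {k V : Type u} [Field k] [AddCommGroup V] [Module k V] {n : ℕ}
  (e : V ≃ₗ[k] k × (Fin n → k))

/-- The multiplication of a fixed element of `X` by elements of the exterior algebra of `k ^ n`. -/
noncomputable def rmul {X : GrMod k V} (x : X.carrier) :
    ExteriorAlgebra k (Fin n → k) →ₗ[k] X.carrier where
  toFun r := MulOpposite.op (incl e r) • x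
  map_add' r s := by rw [map_add, MulOpposite.op_add, add_smul]
  map_smul' c r := by rw [map_smul, MulOpposite.op_smul, smul_assoc, RingHom.id_apply]

variable {X Y : GrMod k V}

theorem rmul_apply (x : X.carrier) (r : ExteriorAlgebra k (Fin n → k)) :
    rmul e x r = MulOpposite.op (incl e r) • x := rfl

theorem rmul_mul (x : X.carrier) (r s : ExteriorAlgebra k (Fin n → k)) :
    rmul e x (r * s) = MulOpposite.op (incl e s) • rmul e x r := by
  rw [rmul_apply, rmul_apply, map_mul, MulOpposite.op_mul, mul_smul]

theorem rmul_algebraMap (x : X.carrier) (c : k) :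
    rmul e x (algebraMap k _ c) = c • x := by
  rw [rmul_apply, AlgHom.commutes, GrMod.op_algebraMap_smul]

theorem rmul_mem {x : X.carrier} (hx : x ∈ X.gr 0) {j : ℤ} {r : ExteriorAlgebra k (Fin n → k)}
    (hr : r ∈ extGr k _ j) : rmul e x r ∈ X.gr j :=
  GrMod.smul_mem_of_mem_extGr (map_mem_extGr _ hr) hx

theorem grProj_rmul {x : X.carrier} (hx : x ∈ X.gr 0) (j : ℤ)
    (r : ExteriorAlgebra k (Fin n → k)) :
    X.grProj j (rmul e x r) = rmul e x (extProjInt j r) := by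
  induction r using extGr_induction with
  | h0 => simp
  | hadd a b ha hb => simp only [map_add, ha, hb]
  | h i r hr =>
    by_cases hij : i = j
    · subst hij
      rw [extProjInt_of_mem hr, GrMod.grProj_of_mem (rmul_mem e hx hr)]
    · rw [extProjInt_of_mem_ne hr hij, GrMod.grProj_of_mem_ne (rmul_mem e hx hr) hij, map_zero]

variable {e} {ξ : V}

/-- A lift `x` of degree zero of the generator of `B / A ≅ R / ⟨ξ⟩` does all this: `R / ⟨ξ⟩` is free
of rank one over the exterior algebra of `k ^ n`, and `ξ` kills its generator. -/
theorem exists_generator (he : e ξ = (1, 0))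
    {A B : Submodule (ExteriorAlgebra k V)ᵐᵒᵖ X.carrier} (hB : IsHomogeneous X B)
    (h : SubquotientIso X (cyclicMod (k := k) ξ) A B) :
    ∃ x ∈ B, x ∈ X.gr 0 ∧ (∀ y ∈ B, ∃ r, y - rmul e x r ∈ A) ∧ (∀ r, rmul e x r ∈ A → r = 0) ∧
      MulOpposite.op (ExteriorAlgebra.ι k ξ) • x ∈ A := by
  obtain ⟨f', hf'⟩ := h
  let f : B →ₗ[(ExteriorAlgebra k V)ᵐᵒᵖ] (cyclicMod (k := k) ξ).carrier :=
    f'.toLinearMap ∘ₗ (A.submoduleOf B).mkQ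
  have hf : ∀ (j : ℤ) (b : B), (b : X.carrier) ∈ X.gr j → f b ∈ (cyclicMod (k := k) ξ).gr j := hf'
  have hsurj : Function.Surjective f := f'.surjective.comp (Submodule.mkQ_surjective _)
  have hker : ∀ y : B, f y = 0 ↔ (y : X.carrier) ∈ A := by
    intro y
    change f' (Submodule.Quotient.mk y) = 0 ↔ _
    rw [LinearEquiv.map_eq_zero_iff, Submodule.Quotient.mk_eq_zero]
    rfl
  let I := idealSpan (k := k) ξ
  let one : (cyclicMod (k := k) ξ).carrier := I.mkQ 1
  obtain ⟨b, hb⟩ := hsurj one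
  have hone : one ∈ (cyclicMod (k := k) ξ).gr 0 := ⟨1, one_mem_extGr_zero, rfl⟩
  -- An arbitrary lift of the generator may have components in other degrees; homogeneity of `B`
  -- allows these to be discarded inside `B`.
  have key : ∀ y ∈ (⨆ j : ℤ, X.gr j ⊓ B.restrictScalars k), ∃ (hy : y ∈ B) (z : B),
      (z : X.carrier) ∈ X.gr 0 ∧ f z = (cyclicMod (k := k) ξ).grProj 0 (f ⟨y, hy⟩) := by
    intro y hy
    induction hy using Submodule.iSup_induction' with
    | mem j y hy =>
      refine ⟨hy.2, ?_⟩
      by_cases hj : j = 0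
      · subst hj
        exact ⟨⟨y, hy.2⟩, hy.1, (GrMod.grProj_of_mem (hf _ _ hy.1)).symm⟩
      · refine ⟨0, Submodule.zero_mem _, ?_⟩
        rw [GrMod.grProj_of_mem_ne (hf _ ⟨y, hy.2⟩ hy.1) hj, map_zero]
    | zero =>
      refine ⟨B.zero_mem, 0, Submodule.zero_mem _, ?_⟩
      have : f ⟨0, B.zero_mem⟩ = 0 := map_zero f
      rw [this, map_zero, map_zero]
    | add x y _ _ hx hy =>
      obtain ⟨hx, z, hz, hz'⟩ := hx
      obtain ⟨hy, w, hw, hw'⟩ := hy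
      refine ⟨B.add_mem hx hy, z + w, Submodule.add_mem _ hz hw, ?_⟩
      rw [map_add, hz', hw', ← map_add, ← map_add]
      rfl
  obtain ⟨_, z, hz, hz'⟩ := key b (hB b.2)
  have hz1 : f z = one := by
    rw [hz', ← GrMod.grProj_of_mem hone, ← hb]
  have hmk : ∀ r : ExteriorAlgebra k V, f (MulOpposite.op r • z) = I.mkQ r := by
    intro r
    rw [map_smul, hz1]
    change I.mkQ (1 * r) = _
    rw [one_mul]
  refine ⟨z, z.2, hz, fun y hy => ?_, fun r hr => ?_, ?_⟩
  · obtain ⟨s, hs⟩ := I.mkQ_surjective (f ⟨y, hy⟩)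
    refine ⟨proj e s, (hker (⟨y, hy⟩ - MulOpposite.op (incl e (proj e s)) • z)).1 ?_⟩
    rw [map_sub, hmk, ← hs]
    change I.mkQ s - I.mkQ _ = 0
    rw [← map_sub]
    exact (Submodule.Quotient.mk_eq_zero _).2 (sub_incl_proj_mem e he s)
  · have := (hker (MulOpposite.op (incl e r) • z)).2 hr
    rw [hmk] at this
    rw [← proj_incl e r]
    exact proj_eq_zero e he ((Submodule.Quotient.mk_eq_zero _).1 this)
  · refine (hker (MulOpposite.op (ExteriorAlgebra.ι k ξ) • z)).1 ?_
    rw [hmk]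
    exact (Submodule.Quotient.mk_eq_zero _).2 (Submodule.mem_span_singleton_self _)

variable (e ξ X) in
/-- A homogeneous basis over the exterior algebra of `k ^ n`, in degree zero, in which `ξ` acts by a
strictly triangular matrix. -/
structure IsFrame {t : ℕ} (x : Fin t → X.carrier) : Prop where
  mem : ∀ l, x l ∈ X.gr 0
  span : ∀ y, ∃ r : Fin t → ExteriorAlgebra k (Fin n → k), y = ∑ l, rmul e (x l) (r l)
  indep : ∀ r : Fin t → ExteriorAlgebra k (Fin n → k), ∑ l, rmul e (x l) (r l) = 0 → r = 0
  triangular : ∀ m, ∃ r : Fin t → ExteriorAlgebra k (Fin n → k), (∀ l, m ≤ l → r l = 0) ∧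
    MulOpposite.op (ExteriorAlgebra.ι k ξ) • x m = ∑ l, rmul e (x l) (r l)

/-- Lifts of the generators of the factors form the frame: free factors make the filtration split
over the exterior algebra of `k ^ n`. -/
theorem exists_isFrame (he : e ξ = (1, 0)) (h : filteredBy (cyclicMod (k := k) ξ) X) :
    ∃ (t : ℕ) (x : Fin t → X.carrier), IsFrame e X ξ x := by
  obtain ⟨t, F, h0, ht, hh, hF⟩ := h
  have hgen : ∀ i : ℕ, ∃ x, i < t → x ∈ F (i + 1) ∧ x ∈ X.gr 0 ∧
      (∀ y ∈ F (i + 1), ∃ r, y - rmul e x r ∈ F i) ∧ (∀ r, rmul e x r ∈ F i → r = 0) ∧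
      MulOpposite.op (ExteriorAlgebra.ι k ξ) • x ∈ F i := by
    intro i
    by_cases hi : i < t
    · obtain ⟨x, hx⟩ := exists_generator he (hh (i + 1) hi) (hF i hi).2
      exact ⟨x, fun _ => hx⟩
    · exact ⟨0, fun h => absurd h hi⟩
  choose x hx using hgen
  have hmono : ∀ m ≤ t, ∀ l < m, x l ∈ F m := by
    intro m hm l hl
    induction m with
    | zero => omega
    | succ m ih =>
      rcases Nat.lt_succ_iff_lt_or_eq.1 hl with h | rfl
      · exact (hF m hm).1 (ih (by omega) h)
      · exact (hx l hm).1
  have hspan : ∀ m ≤ t, ∀ y ∈ F m, ∃ r : ℕ → ExteriorAlgebra k (Fin n → k),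
      y = ∑ l ∈ Finset.range m, rmul e (x l) (r l) := by
    intro m
    induction m with
    | zero =>
      intro _ y hy
      rw [h0, Submodule.mem_bot] at hy
      exact ⟨0, by simpa using hy⟩
    | succ m ih =>
      intro hm y hy
      obtain ⟨s, hs⟩ := (hx m hm).2.2.1 y hy
      obtain ⟨r, hr⟩ := ih (by omega) _ hs
      refine ⟨Function.update r m s, ?_⟩
      rw [Finset.sum_range_succ, Function.update_self, ← sub_eq_iff_eq_add, hr]
      refine Finset.sum_congr rfl fun l hl => ?_
      rw [Function.update_of_ne (Finset.mem_range.1 hl).ne]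
  have hindep : ∀ m ≤ t, ∀ r : ℕ → ExteriorAlgebra k (Fin n → k),
      ∑ l ∈ Finset.range m, rmul e (x l) (r l) = 0 → ∀ l < m, r l = 0 := by
    intro m
    induction m with
    | zero => intro _ r _ l hl; omega
    | succ m ih =>
      intro hm r hr l hl
      rw [Finset.sum_range_succ] at hr
      -- The other terms lie in `F m`, so the relation puts the last one there too, and its
      -- coefficient vanishes.
      have h1 : r m = 0 := by
        refine (hx m hm).2.2.2.1 _ ?_
        rw [eq_neg_of_add_eq_zero_right hr]
        exact neg_mem (Submodule.sum_mem _ fun l hl =>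
          (F m).smul_mem _ (hmono m (by omega) l (Finset.mem_range.1 hl)))
      rw [h1, map_zero, add_zero] at hr
      rcases Nat.lt_succ_iff_lt_or_eq.1 hl with h | rfl
      · exact ih (by omega) r hr l h
      · exact h1
  refine ⟨t, fun l => x l, fun l => (hx l l.2).2.1, fun y => ?_, fun r hr => ?_, fun m => ?_⟩
  · obtain ⟨r, hr⟩ := hspan t le_rfl y (by rw [ht]; trivial)
    exact ⟨fun l => r l, by rw [hr, Finset.sum_range]⟩
  · have := hindep t le_rfl (fun l => if h : l < t then r ⟨l, h⟩ else 0)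
      (by rw [Finset.sum_range, ← hr]; simp)
    ext1 l
    simpa using this l l.2
  -- `ξ` sends `x m` into `F m`, which is spanned by the `x l` with `l < m`.
  · obtain ⟨r, hr⟩ := hspan m m.2.le _ (hx m m.2).2.2.2.2
    refine ⟨fun l => if (l : ℕ) < m then r l else 0, fun l hl => if_neg (not_lt.2 hl), ?_⟩
    rw [hr, ← Finset.sum_range fun l => rmul e (x l) (if l < m then r l else 0)]
    refine (Finset.sum_subset_zero_on_sdiff (Finset.range_mono m.2.le) (fun l hl => ?_)
      (fun l hl => ?_))
    · rw [Finset.mem_sdiff, Finset.mem_range, Finset.mem_range] at hl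
      rw [if_neg hl.2, map_zero]
    · rw [if_pos (Finset.mem_range.1 hl)]

end Filtered

end ExteriorGraded

namespace ExteriorGraded

/-! ### The action of `ξ` on the component of degree zero -/

variable {k V : Type u} [Field k] [AddCommGroup V] [Module k V] {n : ℕ}
  {e : V ≃ₗ[k] k × (Fin n → k)} {ξ : V} {X Y : GrMod k V}

namespace IsFrame

variable {t : ℕ} {x : Fin t → X.carrier}

/-- The frame sits in degree zero, so projecting to degree `j` acts on each coordinate separately;
independence compares the results. -/
theorem coord_mem (hx : IsFrame e X ξ x) {j : ℤ} {r : Fin t → ExteriorAlgebra k (Fin n → k)}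
    (h : ∑ l, rmul e (x l) (r l) ∈ X.gr j) (l : Fin t) : r l ∈ extGr k _ j := by
  have h1 := GrMod.grProj_of_mem h
  simp only [map_sum, grProj_rmul e (hx.mem _)] at h1
  rw [← sub_eq_zero, ← Finset.sum_sub_distrib] at h1
  simp only [← map_sub] at h1
  have h2 := sub_eq_zero.1 (congrFun (hx.indep (fun l => extProjInt j (r l) - r l) h1) l)
  rw [← h2]
  exact extProjInt_mem j _

/-- The basis of the degree zero component given by a frame. -/
noncomputable def basis (hx : IsFrame e X ξ x) : Module.Basis (Fin t) k (X.gr 0) :=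
  Module.Basis.mk (v := fun l => ⟨x l, hx.mem l⟩)
    (by
      rw [Fintype.linearIndependent_iff]
      intro c hc l
      have h1 := congrArg (X.gr 0).subtype hc
      rw [map_sum, map_zero] at h1
      have h2 := congrFun (hx.indep (fun l => algebraMap k _ (c l))
        (by simp only [rmul_algebraMap]; exact h1)) l
      exact (ExteriorAlgebra.algebraMap_eq_zero_iff _ _).1 h2)
    (by
      rintro ⟨y, hy⟩ -
      obtain ⟨r, rfl⟩ := hx.span y
      have h1 : ∀ l, ∃ c : k, algebraMap k _ c = r l := fun l =>
        exists_eq_algebraMap (by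
          have := hx.coord_mem hy l
          rwa [← Nat.cast_zero, extGr_natCast] at this)
      choose c hc using h1
      have : (⟨_, hy⟩ : X.gr 0) = ∑ l, c l • (⟨x l, hx.mem l⟩ : X.gr 0) := by
        apply Subtype.ext
        simp only [← hc, rmul_algebraMap, AddSubmonoidClass.coe_finsetSum, Submodule.coe_smul]
      rw [this]
      exact Submodule.sum_mem _ fun l _ => Submodule.smul_mem _ _ (Submodule.subset_span ⟨l, rfl⟩))

theorem basis_apply (hx : IsFrame e X ξ x) (l : Fin t) : (hx.basis l : X.carrier) = x l := by
  rw [basis, Module.Basis.mk_apply]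

theorem eq_sum_repr (hx : IsFrame e X ξ x) (y : X.gr 0) : (y : X.carrier) = ∑ l, hx.basis.repr y l • x l := by
  conv_lhs => rw [← hx.basis.sum_repr y]
  simp only [AddSubmonoidClass.coe_finsetSum, Submodule.coe_smul, basis_apply]

theorem rmul_coe (hx : IsFrame e X ξ x) (y : X.gr 0) (r : ExteriorAlgebra k (Fin n → k)) :
    rmul e (y : X.carrier) r = ∑ l, rmul e (x l) (hx.basis.repr y l • r) := by
  rw [hx.eq_sum_repr y, rmul_apply, Finset.smul_sum]
  refine Finset.sum_congr rfl fun l _ => ?_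
  rw [map_smul, rmul_apply, smul_comm]

/-- Uniqueness of the components of `ξ`: each frame coordinate of the sum is a vector of `k ^ n`,
and `ι` is injective. -/
theorem eq_zero_of_sum_rmul_gen (hx : IsFrame e X ξ x) (z : Fin n → X.gr 0)
    (h : ∑ i, rmul e (z i : X.carrier) (gen k i) = 0) : z = 0 := by
  simp only [hx.rmul_coe] at h
  rw [Finset.sum_comm] at h
  simp only [← map_sum] at h
  have h1 := hx.indep _ h
  ext1 i
  apply hx.basis.ext_elem
  intro l
  have h2 : ∑ i, hx.basis.repr (z i) l • gen k i = 0 := congrFun h1 l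
  rw [← ι_eq_sum_gen fun i => hx.basis.repr (z i) l, ExteriorAlgebra.ι_eq_zero_iff] at h2
  rw [congrFun h2 i]
  simp

theorem eq_symm_of_sum_rmul_gen_mul_gen (hx : IsFrame e X ξ x) (z : Fin n → Fin n → X.gr 0)
    (h : ∑ i, ∑ j, rmul e (z i j : X.carrier) (gen k i * gen k j) = 0) (p q : Fin n) :
    z p q = z q p := by
  simp only [hx.rmul_coe] at h
  have h0 : ∀ i, ∑ j, ∑ l, rmul e (x l) (hx.basis.repr (z i j) l • (gen k i * gen k j)) =
      ∑ l, rmul e (x l) (∑ j, hx.basis.repr (z i j) l • (gen k i * gen k j)) := fun i => by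
    rw [Finset.sum_comm]
    simp only [map_sum]
  simp only [h0] at h
  rw [Finset.sum_comm] at h
  simp only [← map_sum] at h
  have h1 := hx.indep _ h
  apply hx.basis.ext_elem
  intro l
  exact eq_of_sum_smul_gen_mul_gen_eq_zero (fun i j => hx.basis.repr (z i j) l) (congrFun h1 l) p q

end IsFrame

variable (e X ξ) in
/-- The action of `ξ` on the component of degree zero, written in terms of the generators of the
exterior algebra of `k ^ n`. -/
def IsComponents (A : Fin n → Module.End k (X.gr 0)) : Prop :=
  ∀ y : X.gr 0, MulOpposite.op (ExteriorAlgebra.ι k ξ) • (y : X.carrier) =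
    ∑ i, rmul e (A i y : X.carrier) (gen k i)

theorem isNilpotent_of_triangular {N : Type u} [AddCommGroup N] [Module k N] {t : ℕ}
    (b : Module.Basis (Fin t) k N) (A : Module.End k N)
    (h : ∀ m, A (b m) ∈ Submodule.span k (b '' {l | l < m})) : IsNilpotent A := by
  have key : ∀ s : ℕ, ∀ m : Fin t, (m : ℕ) < s → (A ^ s) (b m) = 0 := by
    intro s
    induction s with
    | zero => intro m hm; omega
    | succ s ih =>
      intro m hm
      rw [pow_succ, Module.End.mul_apply]
      have : Submodule.span k (b '' {l | l < m}) ≤ LinearMap.ker (A ^ s) := by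
        rw [Submodule.span_le]
        rintro _ ⟨l, hl, rfl⟩
        refine ih l ?_
        have : (l : ℕ) < m := hl
        omega
      exact this (h m)
  exact ⟨t, b.ext fun m => by rw [key t m m.2]; rfl⟩

/-- The image of `x m` under `ξ` has degree one, so its frame coordinates are vectors `u m l` of `k
^ n`; their `i`-th entries are the matrix entries of `A i`, and triangularity of the frame makes it
nilpotent. -/
theorem IsFrame.exists_isComponents {t : ℕ} {x : Fin t → X.carrier} (hx : IsFrame e X ξ x) :
    ∃ A : Fin n → Module.End k (X.gr 0), IsComponents e ξ X A ∧ ∀ i, IsNilpotent (A i) := by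
  have h1 : ∀ m, ∃ u : Fin t → Fin n → k, (∀ l, m ≤ l → u l = 0) ∧
      MulOpposite.op (ExteriorAlgebra.ι k ξ) • x m =
        ∑ l, rmul e (x l) (ExteriorAlgebra.ι k (u l)) := by
    intro m
    obtain ⟨r, hr, hr'⟩ := hx.triangular m
    have h2 : ∑ l, rmul e (x l) (r l) ∈ X.gr ((1 : ℕ) : ℤ) := by
      rw [← hr']
      simpa using X.smul_mem 1 0 _ _ (ι_mem_exteriorPower_one ξ) (hx.mem m)
    have h3 : ∀ l, ∃ u : Fin n → k, ExteriorAlgebra.ι k u = r l := fun l =>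
      exists_eq_ι (by simpa only [extGr_natCast] using hx.coord_mem h2 l)
    choose u hu using h3
    refine ⟨u, fun l hl => ?_, by simp only [hr', hu]⟩
    rw [← ExteriorAlgebra.ι_eq_zero_iff (R := k), hu, hr l hl]
  choose u hu hu' using h1
  let A : Fin n → Module.End k (X.gr 0) := fun i =>
    hx.basis.constr k fun m => ∑ l, u m l i • hx.basis l
  have hA : ∀ i m, A i (hx.basis m) = ∑ l, u m l i • hx.basis l := fun i m =>
    hx.basis.constr_basis k _ m
  refine ⟨A, ?_, fun i => ?_⟩
  · let f : X.gr 0 →ₗ[k] X.carrier :=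
      { toFun := fun y => MulOpposite.op (ExteriorAlgebra.ι k ξ) • (y : X.carrier)
        map_add' := fun y z => by rw [Submodule.coe_add, smul_add]
        map_smul' := fun c y => by rw [Submodule.coe_smul, smul_comm, RingHom.id_apply] }
    let g : X.gr 0 →ₗ[k] X.carrier :=
      { toFun := fun y => ∑ i, rmul e (A i y : X.carrier) (gen k i)
        map_add' := fun y z => by
          simp only [map_add, Submodule.coe_add, rmul_apply, smul_add, Finset.sum_add_distrib]
        map_smul' := fun c y => by
          simp only [map_smul, Submodule.coe_smul, rmul_apply, RingHom.id_apply, Finset.smul_sum]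
          exact Finset.sum_congr rfl fun i _ => smul_comm _ _ _ }
    have hfg : f = g := hx.basis.ext fun m => by
      change MulOpposite.op (ExteriorAlgebra.ι k ξ) • (hx.basis m : X.carrier) =
        ∑ i, rmul e (A i (hx.basis m) : X.carrier) (gen k i)
      rw [hx.basis_apply, hu']
      simp only [ι_eq_sum_gen, map_sum]
      rw [Finset.sum_comm]
      refine Finset.sum_congr rfl fun i _ => ?_
      rw [hA, AddSubmonoidClass.coe_finsetSum, rmul_apply, Finset.smul_sum]
      refine Finset.sum_congr rfl fun l _ => ?_
      rw [Submodule.coe_smul, hx.basis_apply, map_smul, rmul_apply, smul_comm]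
    exact fun y => LinearMap.congr_fun hfg y
  · refine isNilpotent_of_triangular hx.basis (A i) fun m => ?_
    rw [hA]
    refine Submodule.sum_mem _ fun l _ => ?_
    by_cases hl : l < m
    · exact Submodule.smul_mem _ _ (Submodule.subset_span ⟨l, hl, rfl⟩)
    · rw [hu m l (not_lt.1 hl), Pi.zero_apply, zero_smul]
      exact Submodule.zero_mem _

theorem smul_rmul_ι (y : X.carrier) (v : V) (u : Fin n → k) :
    MulOpposite.op (ExteriorAlgebra.ι k v) • rmul e y (ExteriorAlgebra.ι k u) =
      -rmul e (MulOpposite.op (ExteriorAlgebra.ι k v) • y) (ExteriorAlgebra.ι k u) := by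
  rw [rmul_apply, rmul_apply, ← mul_smul, ← mul_smul, ← neg_smul, ← MulOpposite.op_mul,
    ← MulOpposite.op_mul, ← MulOpposite.op_neg, incl_ι,
    eq_neg_of_add_eq_zero_left (ExteriorAlgebra.ι_add_mul_swap (R := k) _ v)]

/-- Applying `ξ` twice gives, up to sign, `∑ (A i (A j y)) eᵢ eⱼ`. It vanishes as `ξ² = 0`, which
forces the coefficients to be symmetric. -/
theorem IsFrame.isComponents_comm {t : ℕ} {x : Fin t → X.carrier} (hx : IsFrame e X ξ x)
    {A : Fin n → Module.End k (X.gr 0)} (hA : IsComponents e ξ X A) (i j : Fin n) :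
    A i * A j = A j * A i := by
  refine LinearMap.ext fun y => ?_
  refine hx.eq_symm_of_sum_rmul_gen_mul_gen (fun i j => A i (A j y)) ?_ i j
  have h0 : MulOpposite.op (ExteriorAlgebra.ι k ξ) •
      MulOpposite.op (ExteriorAlgebra.ι k ξ) • (y : X.carrier) = 0 := by
    rw [← mul_smul, ← MulOpposite.op_mul, ExteriorAlgebra.ι_sq_zero, MulOpposite.op_zero, zero_smul]
  rw [hA y, Finset.smul_sum] at h0
  have h1 : ∀ j, MulOpposite.op (ExteriorAlgebra.ι k ξ) • rmul e (A j y : X.carrier) (gen k j) =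
      -∑ i, rmul e (A i (A j y) : X.carrier) (gen k i * gen k j) := fun j => by
    rw [gen, smul_rmul_ι, hA, rmul_apply, Finset.smul_sum]
    simp only [rmul_mul]
  simp only [h1, Finset.sum_neg_distrib, neg_eq_zero] at h0
  rw [Finset.sum_comm]
  exact h0

/-- Expand both sides of `g (y ξ) = g (y) ξ` and use uniqueness of components in `Y`. -/
theorem IsFrame.map_isComponents {t : ℕ} {x : Fin t → Y.carrier} (hx : IsFrame e Y ξ x)
    {A : Fin n → Module.End k (X.gr 0)} (hA : IsComponents e ξ X A)
    {B : Fin n → Module.End k (Y.gr 0)} (hB : IsComponents e ξ Y B)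
    (f : X.gr 0 →ₗ[k] Y.gr 0) (g : X.carrier →ₗ[(ExteriorAlgebra k V)ᵐᵒᵖ] Y.carrier)
    (hg : ∀ y : X.gr 0, g y = f y) (i : Fin n) (y : X.gr 0) : f (A i y) = B i (f y) := by
  refine sub_eq_zero.1 (congrFun
    (hx.eq_zero_of_sum_rmul_gen (fun i => f (A i y) - B i (f y)) ?_) i)
  have h1 := congrArg g (hA y)
  rw [map_smul, hg, hB, map_sum] at h1
  have h2 : ∀ i, g (rmul e (A i y : X.carrier) (gen k i)) =
      rmul e (f (A i y) : Y.carrier) (gen k i) := fun i => by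
    rw [rmul_apply, map_smul, hg, rmul_apply]
  simp only [h2] at h1
  simp only [Submodule.coe_sub, rmul_apply, smul_sub, Finset.sum_sub_distrib] at h1 ⊢
  rw [h1, sub_self]

/-- Freeness of `X` extends `f` linearly over the exterior algebra of `k ^ n`. Compatibility with
`ξ` holds in degree zero by `hf`, and spreads to `X` because `ξ` anticommutes with `k ^ n`. -/
theorem IsFrame.exists_extension {t : ℕ} {x : Fin t → X.carrier} (hx : IsFrame e X ξ x)
    (he : e ξ = (1, 0))
    {A : Fin n → Module.End k (X.gr 0)} (hA : IsComponents e ξ X A)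
    {B : Fin n → Module.End k (Y.gr 0)} (hB : IsComponents e ξ Y B)
    (f : X.gr 0 →ₗ[k] Y.gr 0) (hf : ∀ i y, f (A i y) = B i (f y)) :
    ∃ g : X ⟶ Y, ∀ y : X.gr 0, g.1 y = f y := by
  let Φ : (Fin t → ExteriorAlgebra k (Fin n → k)) →ₗ[k] X.carrier :=
    ∑ l, rmul e (x l) ∘ₗ LinearMap.proj l
  have hΦ : ∀ r, Φ r = ∑ l, rmul e (x l) (r l) := fun r => by simp [Φ]
  have hbij : Function.Bijective Φ := by
    refine ⟨(injective_iff_map_eq_zero Φ).2 fun r hr => hx.indep r (by rw [← hΦ, hr]), fun y => ?_⟩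
    obtain ⟨r, hr⟩ := hx.span y
    exact ⟨r, by rw [hΦ, hr]⟩
  let Ψ := LinearEquiv.ofBijective Φ hbij
  let Γ : (Fin t → ExteriorAlgebra k (Fin n → k)) →ₗ[k] Y.carrier :=
    ∑ l, rmul e (f (hx.basis l) : Y.carrier) ∘ₗ LinearMap.proj l
  have hΓ : ∀ r, Γ r = ∑ l, rmul e (f (hx.basis l) : Y.carrier) (r l) := fun r => by simp [Γ]
  let g : X.carrier →ₗ[k] Y.carrier := Γ ∘ₗ Ψ.symm.toLinearMap
  have hgΦ : ∀ r, g (Φ r) = Γ r := fun r => congrArg Γ (Ψ.symm_apply_apply r)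
  have hincl : ∀ s y, g (MulOpposite.op (incl e s) • y) = MulOpposite.op (incl e s) • g y := by
    intro s y
    obtain ⟨r, rfl⟩ := hbij.2 y
    have : MulOpposite.op (incl e s) • Φ r = Φ fun l => r l * s := by
      rw [hΦ, hΦ, Finset.smul_sum]
      simp only [rmul_mul]
    rw [this, hgΦ, hgΦ, hΓ, hΓ, Finset.smul_sum]
    simp only [rmul_mul]
  have hg0 : ∀ y : X.gr 0, g y = f y := by
    have : g ∘ₗ (X.gr 0).subtype = (Y.gr 0).subtype ∘ₗ f := hx.basis.ext fun l => by
      change g (hx.basis l : X.carrier) = f (hx.basis l)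
      have h1 : (hx.basis l : X.carrier) = Φ (Pi.single l 1) := by
        rw [hΦ, Finset.sum_eq_single l, Pi.single_eq_same, hx.basis_apply, rmul_apply, map_one,
          MulOpposite.op_one, one_smul]
        · intro m _ hm
          rw [Pi.single_eq_of_ne hm, map_zero]
        · simp
      rw [h1, hgΦ, hΓ, Finset.sum_eq_single l, Pi.single_eq_same, rmul_apply, map_one,
        MulOpposite.op_one, one_smul]
      · intro m _ hm
        rw [Pi.single_eq_of_ne hm, map_zero]
      · simp
    exact fun y => LinearMap.congr_fun this y
  have hrmul : ∀ y r, g (rmul e y r) = rmul e (g y) r := fun y r => hincl r y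
  let P : X.carrier → Prop := fun y => g (MulOpposite.op (ExteriorAlgebra.ι k ξ) • y) =
    MulOpposite.op (ExteriorAlgebra.ι k ξ) • g y
  have hP0 : ∀ y : X.gr 0, P y := fun y => by
    change g _ = _ • g y
    rw [hA, map_sum, hg0, hB]
    refine Finset.sum_congr rfl fun i _ => ?_
    rw [hrmul, hg0, hf]
  have hPadd : ∀ y z, P y → P z → P (y + z) := fun y z hy hz => by
    change g _ = _ • g _
    rw [smul_add, map_add, hy, hz, map_add, smul_add]
  -- Moving `ξ` past a vector of `k ^ n` produces the same sign on both sides.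
  have hPr : ∀ r y, P y → P (rmul e y r) := by
    intro r
    induction r using ExteriorAlgebra.induction with
    | algebraMap c =>
      intro y hy
      change g _ = _ • g _
      rw [rmul_algebraMap, smul_comm, map_smul, hy, map_smul, smul_comm]
    | ι u =>
      intro y hy
      change g _ = _ • g _
      rw [smul_rmul_ι, map_neg, hrmul, hy, hrmul, smul_rmul_ι]
    | mul a b ha hb =>
      intro y hy
      rw [rmul_mul]
      exact hb _ (ha y hy)
    | add a b ha hb =>
      intro y hy
      rw [map_add]
      exact hPadd _ _ (ha y hy) (hb y hy)
  have hP : ∀ y, P y := by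
    intro y
    obtain ⟨r, rfl⟩ := hx.span y
    refine Finset.sum_induction _ P hPadd ?_ fun l _ => hPr _ _ ?_
    · change g _ = _ • g _
      rw [smul_zero, map_zero, smul_zero]
    · exact hP0 ⟨x l, hx.mem l⟩
  -- `R` is generated by `ξ` and the image of `incl e`.
  have hV : ∀ r : ExteriorAlgebra k V, ∀ y,
      g (MulOpposite.op r • y) = MulOpposite.op r • g y := by
    intro r
    induction r using ExteriorAlgebra.induction with
    | algebraMap c =>
      intro y
      rw [GrMod.op_algebraMap_smul, GrMod.op_algebraMap_smul, map_smul]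
    | ι v =>
      intro y
      rw [ι_eq_add e he v, MulOpposite.op_add, MulOpposite.op_smul, add_smul, add_smul, map_add,
        hincl, smul_assoc, smul_assoc, map_smul]
      congr 2
      exact hP y
    | mul a b ha hb =>
      intro y
      rw [MulOpposite.op_mul, mul_smul, mul_smul, hb, ha]
    | add a b ha hb =>
      intro y
      rw [MulOpposite.op_add, add_smul, add_smul, map_add, ha, hb]
  refine ⟨⟨{ toFun := g, map_add' := map_add g, map_smul' := fun r y => hV r.unop y }, ?_⟩, hg0⟩
  intro j y hy
  change g y ∈ Y.gr j
  obtain ⟨r, rfl⟩ := hbij.2 y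
  rw [hgΦ, hΓ]
  rw [hΦ] at hy
  exact Submodule.sum_mem _ fun l _ => rmul_mem e (f (hx.basis l)).2 (hx.coord_mem hy l)

/-- A graded homomorphism is determined by its values in degree zero. -/
theorem IsFrame.hom_ext {t : ℕ} {x : Fin t → X.carrier} (hx : IsFrame e X ξ x) {f g : X ⟶ Y}
    (h : ∀ y ∈ X.gr 0, f.1 y = g.1 y) : f = g := by
  refine Subtype.ext (LinearMap.ext fun y => ?_)
  obtain ⟨r, rfl⟩ := hx.span y
  rw [map_sum, map_sum]
  refine Finset.sum_congr rfl fun l _ => ?_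
  rw [rmul_apply, map_smul, map_smul, h _ (hx.mem l)]

end ExteriorGraded

namespace ExteriorGraded

/-! ### Filtered modules built from commuting triangular matrices -/

variable {k V : Type u} [Field k] [AddCommGroup V] [Module k V] {n t : ℕ}
  (e : V ≃ₗ[k] k × (Fin n → k)) (u : Fin t → Fin t → Fin n → k)

/-- The matrices through which `V` acts on the free module with `ξ`-action given by `u`. -/
noncomputable def rowMatrix :
    V →ₗ[k] Matrix (Fin t) (Fin t) (ExteriorAlgebra k (Fin n → k)) where
  toFun v := Matrix.of fun b c =>
    ExteriorAlgebra.ι k ((e v).1 • u b c + if b = c then (e v).2 else 0)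
  map_add' v w := by
    ext b c : 2
    rw [Matrix.add_apply, Matrix.of_apply, Matrix.of_apply, Matrix.of_apply, ← map_add]
    congr 1
    split_ifs
    · simp only [map_add, Prod.fst_add, Prod.snd_add, add_smul]; abel
    · simp only [map_add, Prod.fst_add, add_smul, add_zero]
  map_smul' a v := by
    ext b c : 2
    rw [RingHom.id_apply, Matrix.smul_apply, Matrix.of_apply, Matrix.of_apply, ← map_smul]
    congr 1
    split_ifs
    · simp only [map_smul, Prod.smul_fst, Prod.smul_snd, smul_add, smul_assoc]
    · simp only [map_smul, Prod.smul_fst, add_zero, smul_assoc]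

theorem ι_mul_ι_eq_sum (v w : Fin n → k) : ExteriorAlgebra.ι k v * ExteriorAlgebra.ι k w =
    ∑ i, ∑ j, (v i * w j) • (gen k i * gen k j) := by
  rw [ι_eq_sum_gen v, ι_eq_sum_gen w, Finset.sum_mul]
  refine Finset.sum_congr rfl fun i _ => ?_
  rw [Finset.mul_sum]
  exact Finset.sum_congr rfl fun j _ => smul_mul_smul_comm _ _ _ _

/-- Each entry of the square is a quadratic expression in the generators with symmetric
coefficients, hence zero. This is the relation needed to extend the action of `V` to `⋀ V`. -/
theorem rowMatrix_mul_self
    (hcomm : ∀ b d i j, ∑ c, u b c i * u c d j = ∑ c, u b c j * u c d i) (v : V) :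
    rowMatrix e u v * rowMatrix e u v = 0 := by
  ext b d : 2
  rw [Matrix.mul_apply, Matrix.zero_apply]
  simp only [rowMatrix, LinearMap.coe_mk, AddHom.coe_mk, Matrix.of_apply, ι_mul_ι_eq_sum]
  rw [Finset.sum_comm]
  have h1 : ∀ i : Fin n, (∑ c, ∑ j, (((e v).1 • u b c + if b = c then (e v).2 else 0) i *
      ((e v).1 • u c d + if c = d then (e v).2 else 0) j) • (gen k i * gen k j)) =
      ∑ j, (∑ c, ((e v).1 • u b c + if b = c then (e v).2 else 0) i *
      ((e v).1 • u c d + if c = d then (e v).2 else 0) j) • (gen k i * gen k j) := fun i => by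
    rw [Finset.sum_comm]
    simp only [Finset.sum_smul]
  simp only [h1]
  refine sum_smul_gen_mul_gen_eq_zero _ fun i j => ?_
  -- Exchanging `i` and `j` fixes the first term by `hcomm`, swaps the two mixed terms and fixes the
  -- last.
  have h2 : ∀ i j, (∑ c, ((e v).1 • u b c + if b = c then (e v).2 else 0) i *
      ((e v).1 • u c d + if c = d then (e v).2 else 0) j) =
      (e v).1 * (e v).1 * (∑ c, u b c i * u c d j) + (e v).1 * u b d i * (e v).2 j +
      (e v).2 i * ((e v).1 * u b d j) + if b = d then (e v).2 i * (e v).2 j else 0 := by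
    intro i j
    have h3 : ∀ (p : Prop) [Decidable p] (i : Fin n), (if p then (e v).2 else 0) i =
      if p then (e v).2 i else 0 := fun p _ i => by split_ifs <;> rfl
    simp only [Pi.add_apply, Pi.smul_apply, smul_eq_mul, h3, add_mul, mul_add,
      Finset.sum_add_distrib, mul_ite, ite_mul, mul_zero, zero_mul, Finset.sum_ite_eq,
      Finset.sum_ite_eq', Finset.mem_univ, if_true, Finset.mul_sum]
    rw [add_assoc, add_assoc, add_assoc]
    congr 1
    · exact Finset.sum_congr rfl fun c _ => by ring
    · split_ifs <;> ring
  rw [h2, h2, hcomm]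
  split_ifs <;> ring

variable (hcomm : ∀ b d i j, ∑ c, u b c i * u c d j = ∑ c, u b c j * u c d i)

/-- The homomorphism from `⋀ V` to matrices over the exterior algebra of `k ^ n` describing the free
module with `ξ`-action given by `u`. -/
noncomputable def rowHom :
    ExteriorAlgebra k V →ₐ[k] Matrix (Fin t) (Fin t) (ExteriorAlgebra k (Fin n → k)) :=
  ExteriorAlgebra.lift k ⟨rowMatrix e u, rowMatrix_mul_self e u hcomm⟩

theorem rowHom_ι_apply (v : V) (b c : Fin t) : rowHom e u hcomm (ExteriorAlgebra.ι k v) b c =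
    ExteriorAlgebra.ι k ((e v).1 • u b c + if b = c then (e v).2 else 0) := by
  rw [rowHom, ExteriorAlgebra.lift_ι_apply]
  rfl

theorem rowHom_incl (r : ExteriorAlgebra k (Fin n → k)) :
    rowHom e u hcomm (incl e r) = Matrix.diagonal fun _ => r := by
  induction r using ExteriorAlgebra.induction with
  | algebraMap c => rw [AlgHom.commutes, AlgHom.commutes]; rfl
  | ι v =>
    ext b c : 2
    rw [incl_ι, rowHom_ι_apply, Matrix.diagonal_apply]
    split_ifs <;> simp
  | mul a b ha hb => rw [map_mul, map_mul, ha, hb, Matrix.diagonal_mul_diagonal]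
  | add a b ha hb => rw [map_add, map_add, ha, hb, Matrix.diagonal_add]

theorem rowHom_apply_mem {i : ℕ} {r : ExteriorAlgebra k V} (hr : r ∈ ⋀[k]^i V) (b c : Fin t) :
    rowHom e u hcomm r b c ∈ ⋀[k]^i (Fin n → k) := by
  induction hr using Submodule.pow_induction_on_left' generalizing b c with
  | algebraMap a =>
    rw [AlgHom.commutes, Matrix.algebraMap_matrix_apply]
    split_ifs
    · exact SetLike.algebraMap_mem_graded (fun i : ℕ => ⋀[k]^i (Fin n → k)) a
    · exact Submodule.zero_mem _
  | add x y i _ _ hx hy =>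
    rw [map_add, Matrix.add_apply]
    exact Submodule.add_mem _ (hx b c) (hy b c)
  | mem_mul m hm i x _ hx =>
    obtain ⟨v, rfl⟩ := hm
    rw [map_mul, Matrix.mul_apply, Nat.succ_eq_one_add]
    refine Submodule.sum_mem _ fun d _ => ?_
    rw [rowHom_ι_apply]
    exact SetLike.mul_mem_graded (A := fun i : ℕ => ⋀[k]^i (Fin n → k))
      (ι_mem_exteriorPower_one _) (hx d c)

/-- Triangular matrices multiply diagonally along the diagonal, where `u` contributes nothing. The
vanishing above the diagonal gives the filtration; the diagonal entries give its factors. -/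
theorem rowHom_apply_of_le (htri : ∀ b c, b ≤ c → u b c = 0) (r : ExteriorAlgebra k V) :
    (∀ b c, b < c → rowHom e u hcomm r b c = 0) ∧ ∀ b, rowHom e u hcomm r b b = proj e r := by
  induction r using ExteriorAlgebra.induction with
  | algebraMap a =>
    simp only [AlgHom.commutes, Matrix.algebraMap_matrix_apply]
    exact ⟨fun b c h => if_neg h.ne, fun b => if_pos trivial⟩
  | ι v =>
    simp only [rowHom_ι_apply, proj_ι]
    exact ⟨fun b c h => by rw [htri b c h.le, if_neg h.ne]; simp,
      fun b => by rw [htri b b le_rfl]; simp⟩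
  | mul r s hr hs =>
    simp only [map_mul, Matrix.mul_apply]
    refine ⟨fun b c h => Finset.sum_eq_zero fun d _ => ?_, fun b => ?_⟩
    · rcases lt_or_ge b d with h' | h'
      · rw [hr.1 b d h', zero_mul]
      · rw [hs.1 d c (h'.trans_lt h), mul_zero]
    · rw [Finset.sum_eq_single b, hr.2, hs.2]
      · intro d _ hd
        rcases lt_or_gt_of_ne hd with h' | h'
        · rw [hs.1 d b h', mul_zero]
        · rw [hr.1 b d h', zero_mul]
      · simp
  | add r s hr hs =>
    simp only [map_add, Matrix.add_apply]
    exact ⟨fun b c h => by rw [hr.1 b c h, hs.1 b c h, add_zero], fun b => by rw [hr.2, hs.2]⟩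

/-- Row vectors over the exterior algebra of `k ^ n`, with right multiplication by matrices. -/
def RowModule (_ : ExteriorAlgebra k V →ₐ[k]
    Matrix (Fin t) (Fin t) (ExteriorAlgebra k (Fin n → k))) : Type u :=
  Fin t → ExteriorAlgebra k (Fin n → k)

namespace RowModule

variable (φ : ExteriorAlgebra k V →ₐ[k] Matrix (Fin t) (Fin t) (ExteriorAlgebra k (Fin n → k)))

noncomputable instance : AddCommGroup (RowModule φ) :=
  inferInstanceAs (AddCommGroup (Fin t → ExteriorAlgebra k (Fin n → k)))

noncomputable instance : Module k (RowModule φ) :=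
  inferInstanceAs (Module k (Fin t → ExteriorAlgebra k (Fin n → k)))

noncomputable instance : Module (ExteriorAlgebra k V)ᵐᵒᵖ (RowModule φ) where
  smul r x := Matrix.vecMul x (φ r.unop)
  one_smul x := (congrArg (Matrix.vecMul x) (map_one φ)).trans (Matrix.vecMul_one _)
  mul_smul r s x := (congrArg (Matrix.vecMul x) (map_mul φ s.unop r.unop)).trans
    (Matrix.vecMul_vecMul _ _ _).symm
  smul_zero _ := Matrix.zero_vecMul _
  smul_add _ _ _ := Matrix.add_vecMul _ _ _
  add_smul r s x := (congrArg (Matrix.vecMul x) (map_add φ r.unop s.unop)).trans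
    (Matrix.vecMul_add _ _ _)
  zero_smul x := (congrArg (Matrix.vecMul x) (map_zero φ)).trans (Matrix.vecMul_zero _)

variable {φ}

theorem smul_apply (r : ExteriorAlgebra k V) (x : RowModule φ) (a : Fin t) :
    (MulOpposite.op r • x) a = ∑ b, x b * φ r b a := rfl

instance : IsScalarTower k (ExteriorAlgebra k V)ᵐᵒᵖ (RowModule φ) where
  smul_assoc c r x := (congrArg (Matrix.vecMul x) (map_smul φ c r.unop)).trans
    (Matrix.vecMul_smul _ _ _)

/-- The graded components of the module of row vectors. -/
def gr (φ : ExteriorAlgebra k V →ₐ[k] Matrix (Fin t) (Fin t) (ExteriorAlgebra k (Fin n → k)))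
    (j : ℤ) : Submodule k (RowModule φ) where
  carrier := {x | ∀ a, x a ∈ extGr k _ j}
  add_mem' hx hy a := Submodule.add_mem _ (hx a) (hy a)
  zero_mem' _ := Submodule.zero_mem _
  smul_mem' c _ hx a := Submodule.smul_mem _ c (hx a)

/-- The row vector with a single nonzero entry. -/
def single (a : Fin t) : ExteriorAlgebra k (Fin n → k) →ₗ[k] RowModule φ :=
  LinearMap.single k (fun _ => ExteriorAlgebra k (Fin n → k)) a

theorem single_same (a : Fin t) (r : ExteriorAlgebra k (Fin n → k)) :
    (single a r : RowModule φ) a = r := Pi.single_eq_same (M := fun _ => _) a r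

theorem single_of_ne {a b : Fin t} (h : b ≠ a) (r : ExteriorAlgebra k (Fin n → k)) :
    (single a r : RowModule φ) b = 0 := Pi.single_eq_of_ne (M := fun _ => _) h r

theorem sum_single (x : RowModule φ) : ∑ a, single a (x a) = x :=
  Finset.univ_sum_single (M := fun _ => _) x

theorem single_mem_gr (a : Fin t) {j : ℤ} {r : ExteriorAlgebra k (Fin n → k)}
    (hr : r ∈ extGr k _ j) : (single a r : RowModule φ) ∈ gr φ j := by
  intro b
  by_cases h : b = a
  · subst h; rwa [single_same]
  · rw [single_of_ne h]; exact Submodule.zero_mem _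

/-- Taking `N = ⊤` shows that the components span; taking a step of the filtration for `N` shows
that the step is homogeneous. -/
theorem mem_iSup_gr_inf (N : Submodule k (RowModule φ)) (x : RowModule φ)
    (hN : ∀ a r, x a ≠ 0 → single a r ∈ N) : x ∈ ⨆ j, gr φ j ⊓ N := by
  rw [← sum_single x]
  refine Submodule.sum_mem _ fun a _ => ?_
  by_cases ha : x a = 0
  · rw [ha, map_zero]; exact Submodule.zero_mem _
  · induction x a using extGr_induction with
    | h0 => rw [map_zero]; exact Submodule.zero_mem _
    | hadd r s hr hs => rw [map_add]; exact Submodule.add_mem _ hr hs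
    | h j r hr => exact Submodule.mem_iSup_of_mem j ⟨single_mem_gr a hr, hN a r ha⟩

theorem isInternal_gr : DirectSum.IsInternal (gr φ) := by
  refine isInternal_of_proj _ (fun j =>
    { toFun := fun x => (fun a => extProjInt j (x a) : Fin t → _)
      map_add' := fun x y => funext fun a => map_add (extProjInt j) (x a) (y a)
      map_smul' := fun c x => funext fun a => map_smul (extProjInt j) c (x a) }) ?_ ?_ ?_
  · exact fun j x hx => funext fun a => extProjInt_of_mem (hx a)
  · exact fun i j hij x hx => funext fun a => extProjInt_of_mem_ne (hx a) hij
  · rw [eq_top_iff]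
    rintro x -
    simpa using mem_iSup_gr_inf ⊤ x fun _ _ _ => trivial

end RowModule

/-- The graded module which is free over the exterior algebra of `k ^ n`, with `ξ`-action given by
`u`. -/
noncomputable def freeMod : GrMod k V where
  carrier := RowModule (rowHom e u hcomm)
  finite := by
    classical
    refine ⟨⟨Finset.univ.image fun a => RowModule.single a 1, ?_⟩⟩
    rw [eq_top_iff]
    rintro x -
    rw [← RowModule.sum_single x]
    refine Submodule.sum_mem _ fun a _ => ?_
    have : (RowModule.single a (x a) : RowModule (rowHom e u hcomm)) =
        MulOpposite.op (incl e (x a)) • RowModule.single a 1 := by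
      funext b
      rw [RowModule.smul_apply, rowHom_incl, Finset.sum_eq_single a, RowModule.single_same, one_mul,
        Matrix.diagonal_apply]
      · split_ifs with h
        · subst h; rw [RowModule.single_same]
        · rw [RowModule.single_of_ne (Ne.symm h)]
      · intro c _ hc
        rw [RowModule.single_of_ne hc, zero_mul]
      · simp
    rw [this]
    exact Submodule.smul_mem _ _ (Submodule.subset_span (by simp))
  gr := RowModule.gr _
  isInternal := RowModule.isInternal_gr
  smul_mem i j r x hr hx a := by
    rw [RowModule.smul_apply]
    exact Submodule.sum_mem _ fun b _ => mul_mem_extGr (hx b) (rowHom_apply_mem e u hcomm hr b a)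

/-- An entry of a row vector. -/
def freeModEntry (a : Fin t) :
    (freeMod e u hcomm).carrier →ₗ[k] ExteriorAlgebra k (Fin n → k) where
  toFun x := (show RowModule (rowHom e u hcomm) from x) a
  map_add' _ _ := rfl
  map_smul' _ _ := rfl

theorem freeModEntry_smul (a : Fin t) (r : ExteriorAlgebra k V) (x : (freeMod e u hcomm).carrier) :
    freeModEntry e u hcomm a (MulOpposite.op r • x) =
      ∑ b, freeModEntry e u hcomm b x * rowHom e u hcomm r b a := rfl

/-- The submodule of row vectors supported in the first `m` entries. -/
def freeModFiltration (htri : ∀ b c, b ≤ c → u b c = 0) (m : ℕ) :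
    Submodule (ExteriorAlgebra k V)ᵐᵒᵖ (freeMod e u hcomm).carrier where
  carrier := {x | ∀ a : Fin t, m ≤ a → freeModEntry e u hcomm a x = 0}
  add_mem' hx hy a ha := by rw [map_add, hx a ha, hy a ha, add_zero]
  zero_mem' a _ := map_zero (freeModEntry e u hcomm a)
  smul_mem' r x hx a ha := by
    rw [← MulOpposite.op_unop r, freeModEntry_smul]
    refine Finset.sum_eq_zero fun b _ => ?_
    rcases le_or_gt m b with h | h
    · rw [hx b h, zero_mul]
    · rw [(rowHom_apply_of_le e u hcomm htri r.unop).1 b a (Fin.lt_def.2 (by omega)), mul_zero]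

/-- On row vectors supported in the first `m + 1` entries, `r` acts on the last of these through the
diagonal entry `proj e r`. Reading that entry modulo `⟨ξ⟩` is therefore linear, and its kernel is
the previous step. -/
theorem filteredBy_freeMod (htri : ∀ b c, b ≤ c → u b c = 0) {ξ : V} (he : e ξ = (1, 0)) :
    filteredBy (cyclicMod (k := k) ξ) (freeMod e u hcomm) := by
  refine ⟨t, freeModFiltration e u hcomm htri, ?_, ?_, fun i _ x hx => ?_, fun m hm => ⟨?_, ?_⟩⟩
  · rw [eq_bot_iff]
    exact fun x hx => funext fun a => hx a (Nat.zero_le _)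
  · rw [eq_top_iff]
    exact fun x _ a ha => absurd a.2 (not_lt.2 ha)
  · refine RowModule.mem_iSup_gr_inf _ x fun a r ha b hb => ?_
    refine RowModule.single_of_ne (φ := rowHom e u hcomm) (fun hba => ?_) r
    subst hba
    exact ha (hx b hb)
  · exact fun x hx a ha => hx a (by omega)
  · let f : freeModFiltration e u hcomm htri (m + 1) →ₗ[(ExteriorAlgebra k V)ᵐᵒᵖ]
        (ExteriorAlgebra k V ⧸ idealSpan (k := k) ξ) :=
      { toFun := fun x => Submodule.Quotient.mk (incl e (freeModEntry e u hcomm ⟨m, hm⟩ x))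
        map_add' := fun x y => by
          rw [← Submodule.Quotient.mk_add, ← map_add, ← map_add]
          rfl
        map_smul' := fun r x => by
          rw [RingHom.id_apply, ← Submodule.Quotient.mk_smul, Submodule.Quotient.eq]
          have h1 : freeModEntry e u hcomm ⟨m, hm⟩ (r • (x : (freeMod e u hcomm).carrier)) =
              freeModEntry e u hcomm ⟨m, hm⟩ x * proj e r.unop := by
            rw [← MulOpposite.op_unop r, freeModEntry_smul, MulOpposite.unop_op]
            rw [Finset.sum_eq_single ⟨m, hm⟩, (rowHom_apply_of_le e u hcomm htri r.unop).2]
            · intro b _ hb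
              rcases le_or_gt (m + 1) b with h | h
              · rw [x.2 b h, zero_mul]
              · have : (b : ℕ) ≠ m := fun h => hb (Fin.ext h)
                rw [(rowHom_apply_of_le e u hcomm htri r.unop).1 b _
                  (Fin.lt_def.2 (by change (b : ℕ) < m; omega)), mul_zero]
            · simp
          change incl e (freeModEntry e u hcomm ⟨m, hm⟩ (r • (x : (freeMod e u hcomm).carrier))) -
            _ * r.unop ∈ _
          rw [h1, map_mul]
          rw [← mul_sub, ← neg_sub r.unop, mul_neg]
          exact neg_mem (mul_mem_idealSpan ξ _ (sub_incl_proj_mem e he _)) }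
    have hf : Function.Surjective f := by
      intro y
      obtain ⟨s, rfl⟩ := Submodule.Quotient.mk_surjective _ y
      refine ⟨⟨RowModule.single (φ := rowHom e u hcomm) ⟨m, hm⟩ (proj e s), fun a ha => ?_⟩, ?_⟩
      · refine RowModule.single_of_ne (φ := rowHom e u hcomm) (fun h => ?_) _
        subst h
        change m + 1 ≤ m at ha
        omega
      · change Submodule.Quotient.mk (incl e ((RowModule.single ⟨m, hm⟩ (proj e s) :
          RowModule (rowHom e u hcomm)) ⟨m, hm⟩)) = _
        rw [RowModule.single_same, eq_comm, Submodule.Quotient.eq]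
        exact sub_incl_proj_mem e he s
    have hker : (freeModFiltration e u hcomm htri m).submoduleOf
        (freeModFiltration e u hcomm htri (m + 1)) = LinearMap.ker f := by
      ext x
      rw [LinearMap.mem_ker]
      constructor
      · intro hx
        have : freeModEntry e u hcomm ⟨m, hm⟩ x = 0 := hx ⟨m, hm⟩ le_rfl
        change Submodule.Quotient.mk (incl e (freeModEntry e u hcomm ⟨m, hm⟩ x)) = _
        rw [this, map_zero]
        rfl
      · intro hx a ha
        rcases Nat.lt_or_eq_of_le ha with h | h
        · exact x.2 a h
        · obtain rfl : a = ⟨m, hm⟩ := Fin.ext h.symm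
          have := proj_eq_zero e he ((Submodule.Quotient.mk_eq_zero _).1 hx)
          rwa [proj_incl] at this
    refine ⟨(Submodule.quotEquivOfEq _ _ hker).trans (f.quotKerEquivOfSurjective hf),
      fun j b hb => ?_⟩
    exact ⟨incl e (freeModEntry e u hcomm ⟨m, hm⟩ b), map_mem_extGr _ (hb _), rfl⟩

end ExteriorGraded

namespace ExteriorGraded

/-! ### The equivalence of categories -/

variable {k V : Type u} [Field k] [AddCommGroup V] [Module k V] {n : ℕ}
  {e : V ≃ₗ[k] k × (Fin n → k)} {ξ : V}

/-- Components are unique and the variables determine the action on a finite dimensional module, so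
choosing `φ` later is harmless. -/
theorem exists_evaluation (he : e ξ = (1, 0)) {X : GrMod k V}
    (hX : filteredBy (cyclicMod (k := k) ξ) X) :
    ∃ φ : MvPowerSeries (Fin n) k →ₐ[k] Module.End k (X.gr 0),
      IsComponents e ξ X fun i => φ (MvPowerSeries.X i) := by
  obtain ⟨t, x, hx⟩ := exists_isFrame he hX
  obtain ⟨A, hA, hn⟩ := hx.exists_isComponents
  obtain ⟨φ, hφ⟩ := MvPowerSeries.exists_algHom_X_eq A (hx.isComponents_comm hA) hn
  exact ⟨φ, by simpa only [hφ] using hA⟩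

/-- The action of the power series ring on the degree zero component of a module in `F(M)`. -/
noncomputable def evaluation (he : e ξ = (1, 0))
    (X : (filteredBy (cyclicMod (k := k) ξ)).FullSubcategory) :
    MvPowerSeries (Fin n) k →ₐ[k] Module.End k (X.obj.gr 0) :=
  (exists_evaluation he X.property).choose

theorem isComponents_evaluation (he : e ξ = (1, 0))
    (X : (filteredBy (cyclicMod (k := k) ξ)).FullSubcategory) :
    IsComponents e ξ X.obj fun i => evaluation he X (MvPowerSeries.X i) :=
  (exists_evaluation he X.property).choose_spec

/-- The degree zero component of a module in `F(M)`, as a module over the power series ring. -/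
def ZeroPart (_ : e ξ = (1, 0)) (X : (filteredBy (cyclicMod (k := k) ξ)).FullSubcategory) :
    Type u := X.obj.gr 0

namespace ZeroPart

variable (he : e ξ = (1, 0)) (X Y : (filteredBy (cyclicMod (k := k) ξ)).FullSubcategory)

instance : AddCommGroup (ZeroPart he X) := inferInstanceAs (AddCommGroup (X.obj.gr 0))

instance : Module k (ZeroPart he X) := inferInstanceAs (Module k (X.obj.gr 0))

noncomputable instance : Module (MvPowerSeries (Fin n) k) (ZeroPart he X) :=
  Module.compHom (X.obj.gr 0) (evaluation he X).toRingHom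

theorem smul_def (s : MvPowerSeries (Fin n) k) (y : ZeroPart he X) :
    s • y = evaluation he X s y := rfl

instance : IsScalarTower k (MvPowerSeries (Fin n) k) (ZeroPart he X) where
  smul_assoc c s y := by
    rw [smul_def, map_smul]
    rfl

instance : Module.Finite k (ZeroPart he X) := by
  obtain ⟨t, x, hx⟩ := exists_isFrame he X.property
  exact Module.Finite.of_basis hx.basis

variable {X Y}

/-- The restriction of a homomorphism to the components of degree zero. -/
def mapBase (f : X ⟶ Y) : ZeroPart he X →ₗ[k] ZeroPart he Y where
  toFun y := ⟨f.hom.1 y.1, f.hom.2 0 _ y.2⟩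
  map_add' y z := Subtype.ext (map_add f.hom.1 y.1 z.1)
  map_smul' c y := Subtype.ext ((f.hom.1.restrictScalars k).map_smul c y.1)

/-- The restriction of a homomorphism to the components of degree zero is linear over the power
series ring. -/
noncomputable def map (f : X ⟶ Y) : ZeroPart he X →ₗ[MvPowerSeries (Fin n) k] ZeroPart he Y :=
  { mapBase he f with
    map_smul' := fun s y => by
      obtain ⟨t, x, hx⟩ := exists_isFrame he Y.property
      exact MvPowerSeries.map_smul_of_map_X_smul (mapBase he f)
        (fun i y => hx.map_isComponents (isComponents_evaluation he X)
          (isComponents_evaluation he Y) (mapBase he f) f.hom.1 (fun _ => rfl) i y) s y }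

theorem map_injective {f g : X ⟶ Y} (h : map he f = map he g) : f = g := by
  obtain ⟨t, x, hx⟩ := exists_isFrame he X.property
  exact ObjectProperty.hom_ext _ (hx.hom_ext fun y hy =>
    congrArg Subtype.val (LinearMap.congr_fun h ⟨y, hy⟩))

theorem map_surjective (g : ZeroPart he X →ₗ[MvPowerSeries (Fin n) k] ZeroPart he Y) :
    ∃ f : X ⟶ Y, map he f = g := by
  obtain ⟨t, x, hx⟩ := exists_isFrame he X.property
  obtain ⟨f, hf⟩ := hx.exists_extension he (isComponents_evaluation he X)
    (isComponents_evaluation he Y) (g.restrictScalars k)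
    (fun i y => g.map_smul (MvPowerSeries.X i) y)
  exact ⟨ObjectProperty.homMk f, LinearMap.ext fun y => Subtype.ext (hf y)⟩

end ZeroPart

/-- The matrices of the variables in a triangular basis are the input of `freeMod`; the degree zero
part of the result consists of the row vectors with scalar entries, a copy of `N`. -/
theorem exists_linearEquiv_zeroPart (he : e ξ = (1, 0)) (N : Type u) [AddCommGroup N] [Module k N]
    [Module (MvPowerSeries (Fin n) k) N] [IsScalarTower k (MvPowerSeries (Fin n) k) N]
    [Module.Finite k N] : ∃ X, Nonempty (ZeroPart he X ≃ₗ[MvPowerSeries (Fin n) k] N) := by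
  obtain ⟨b, hb⟩ := MvPowerSeries.exists_basis_X_smul_mem_span (k := k) (n := n) _ N rfl
  let u : Fin (Module.finrank k N) → Fin (Module.finrank k N) → Fin n → k := fun p q i =>
    b.repr ((MvPowerSeries.X i : MvPowerSeries (Fin n) k) • b p) q
  have hu : ∀ i (y : N) q, b.repr ((MvPowerSeries.X i : MvPowerSeries (Fin n) k) • y) q =
      ∑ p, b.repr y p * u p q i := by
    intro i y q
    conv_lhs => rw [← b.sum_repr y, Finset.smul_sum]
    simp only [smul_comm _ (b.repr y _), map_sum, map_smul, Finsupp.coe_finsetSum,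
      Finset.sum_apply, Finsupp.smul_apply, smul_eq_mul]
    rfl
  have htri : ∀ p q, p ≤ q → u p q = 0 := by
    intro p q hpq
    ext i
    by_contra h
    have := (b.mem_span_image.1 (hb i p)) (Finsupp.mem_support_iff.2 h)
    exact absurd this (not_lt.2 hpq)
  have hcomm : ∀ p q i j, ∑ c, u p c i * u c q j = ∑ c, u p c j * u c q i := by
    intro p q i j
    rw [← hu, ← hu, smul_comm]
  let X : (filteredBy (cyclicMod (k := k) ξ)).FullSubcategory :=
    ⟨freeMod e u hcomm, filteredBy_freeMod e u hcomm htri he⟩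
  let θ : N →ₗ[k] ZeroPart he X :=
    { toFun := fun y => ⟨(fun a => algebraMap k _ (b.repr y a) : Fin _ → _), fun a => by
        have := SetLike.algebraMap_mem_graded (fun i : ℕ => ⋀[k]^i (Fin n → k)) (b.repr y a)
        rwa [← Nat.cast_zero, extGr_natCast]⟩
      map_add' := fun y z => Subtype.ext <| funext fun a =>
        (congrArg (algebraMap k _) (by rw [map_add]; rfl)).trans (map_add _ _ _)
      map_smul' := fun c y => Subtype.ext <| funext fun a =>
        (congrArg (algebraMap k _) (by rw [map_smul]; rfl)).trans
          ((Algebra.linearMap k (ExteriorAlgebra k (Fin n → k))).map_smul c _) }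
  have hθ : ∀ y a, freeModEntry e u hcomm a (θ y).1 = algebraMap k _ (b.repr y a) := fun _ _ => rfl
  have hθbij : Function.Bijective θ := by
    constructor
    · refine (injective_iff_map_eq_zero θ).2 fun y hy => b.ext_elem fun a => ?_
      have h1 := hθ y a
      rw [hy] at h1
      rw [map_zero, Finsupp.zero_apply, ← ExteriorAlgebra.algebraMap_eq_zero_iff (Fin n → k), ← h1]
      rfl
    · rintro ⟨z, hz⟩
      have h1 : ∀ a, ∃ c : k, algebraMap k _ c = freeModEntry e u hcomm a z := fun a =>
        exists_eq_algebraMap (by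
          have : freeModEntry e u hcomm a z ∈ extGr k _ 0 := hz a
          rwa [← Nat.cast_zero, extGr_natCast] at this)
      choose c hc using h1
      refine ⟨∑ a, c a • b a, Subtype.ext (funext fun a => ?_)⟩
      refine (hθ _ a).trans (Eq.trans ?_ (hc a))
      rw [b.repr_sum_self]
  -- The action of `ξ` on `θ y` is expanded once through the chosen evaluation and once through the
  -- matrices `u`; uniqueness of components equates the two.
  have hX : ∀ i y, θ ((MvPowerSeries.X i : MvPowerSeries (Fin n) k) • y) =
      (MvPowerSeries.X i : MvPowerSeries (Fin n) k) • θ y := by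
    intro i y
    obtain ⟨t, x, hx⟩ := exists_isFrame he X.property
    let z : Fin n → X.obj.gr 0 := fun i => θ ((MvPowerSeries.X i : MvPowerSeries (Fin n) k) • y)
    let w : Fin n → X.obj.gr 0 := fun i => evaluation he X (MvPowerSeries.X i) (θ y)
    have h1 : MulOpposite.op (ExteriorAlgebra.ι k ξ) • (θ y).1 =
        ∑ i, rmul e (w i : X.obj.carrier) (gen k i) := isComponents_evaluation he X (θ y)
    have h2 : MulOpposite.op (ExteriorAlgebra.ι k ξ) • (θ y).1 =
        ∑ i, rmul e (z i : X.obj.carrier) (gen k i) := by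
      refine funext fun a => ?_
      refine Eq.trans ?_ (map_sum (freeModEntry e u hcomm a)
        (fun i => rmul e (z i : X.obj.carrier) (gen k i)) Finset.univ).symm
      refine (freeModEntry_smul e u hcomm a _ _).trans ?_
      have h3 : ∀ i, freeModEntry e u hcomm a (rmul e (z i : X.obj.carrier) (gen k i)) =
          b.repr ((MvPowerSeries.X i : MvPowerSeries (Fin n) k) • y) a • gen k i := by
        intro i
        refine (freeModEntry_smul e u hcomm a _ _).trans ?_
        rw [rowHom_incl, Finset.sum_eq_single a, Matrix.diagonal_apply_eq, Algebra.smul_def]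
        · rfl
        · intro c _ hc
          rw [Matrix.diagonal_apply_ne _ hc, mul_zero]
        · simp
      simp only [h3, hu, hθ, rowHom_ι_apply, he, one_smul, ite_self, add_zero, Finset.sum_smul]
      rw [Finset.sum_comm]
      refine Finset.sum_congr rfl fun p _ => ?_
      rw [ι_eq_sum_gen, ← Algebra.smul_def, Finset.smul_sum]
      exact Finset.sum_congr rfl fun i _ => (mul_smul _ _ _).symm
    refine sub_eq_zero.1 (congrFun (hx.eq_zero_of_sum_rmul_gen (fun i => z i - w i) ?_) i)
    rw [h1] at h2
    simp only [Submodule.coe_sub, rmul_apply, smul_sub, Finset.sum_sub_distrib] at h2 ⊢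
    rw [h2, sub_self]
  let Θ : N →ₗ[MvPowerSeries (Fin n) k] ZeroPart he X :=
    { θ with map_smul' := fun s y => MvPowerSeries.map_smul_of_map_X_smul θ hX s y }
  exact ⟨X, ⟨(LinearEquiv.ofBijective Θ hθbij).symm⟩⟩

/-- The target category measures finiteness by the `k`-structure restricted from power series; the
scalar tower identifies it with the given one. -/
theorem finDimPowerSeriesModule_of (N : Type u) [AddCommGroup N] [Module k N]
    [Module (MvPowerSeries (Fin n) k) N] [IsScalarTower k (MvPowerSeries (Fin n) k) N]
    [hN : Module.Finite k N] :
    finDimPowerSeriesModule k n (ModuleCat.of (MvPowerSeries (Fin n) k) N) := by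
  have h : ‹Module k N› =
      ModuleCat.moduleOfAlgebraModule (ModuleCat.of (MvPowerSeries (Fin n) k) N) :=
    Module.ext' _ _ fun c y => (algebraMap_smul (MvPowerSeries (Fin n) k) c y).symm
  change @Module.Finite k N _ _ (ModuleCat.moduleOfAlgebraModule
    (ModuleCat.of (MvPowerSeries (Fin n) k) N))
  rwa [← h]

/-- Taking the component of degree zero, as a functor to modules over the power series ring. -/
noncomputable def zeroPartFunctor (he : e ξ = (1, 0)) :
    (filteredBy (cyclicMod (k := k) ξ)).FullSubcategory ⥤
      (finDimPowerSeriesModule k n).FullSubcategory :=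
  ObjectProperty.lift _
    { obj := fun X => ModuleCat.of (MvPowerSeries (Fin n) k) (ZeroPart he X)
      map := fun f => ModuleCat.ofHom (ZeroPart.map he f) }
    fun X => finDimPowerSeriesModule_of (ZeroPart he X)

instance (he : e ξ = (1, 0)) : (zeroPartFunctor he).Faithful where
  map_injective h := ZeroPart.map_injective he
    (congrArg (fun f => ModuleCat.Hom.hom f.hom) h)

instance (he : e ξ = (1, 0)) : (zeroPartFunctor he).Full where
  map_surjective g := by
    obtain ⟨f, hf⟩ := ZeroPart.map_surjective he (ModuleCat.Hom.hom g.hom)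
    exact ⟨f, ObjectProperty.hom_ext _ (ModuleCat.hom_ext hf)⟩

open scoped ModuleCat in
instance (he : e ξ = (1, 0)) : (zeroPartFunctor he).EssSurj where
  mem_essImage N := by
    have : Module.Finite k N.obj := N.property
    obtain ⟨X, ⟨f⟩⟩ := exists_linearEquiv_zeroPart he N.obj
    exact ⟨X, ⟨ObjectProperty.isoMk _ f.toModuleIso⟩⟩

instance (he : e ξ = (1, 0)) : (zeroPartFunctor he).IsEquivalence where

instance (he : e ξ = (1, 0)) : (zeroPartFunctor he).Additive where
  map_add := rfl

instance (he : e ξ = (1, 0)) : (zeroPartFunctor he).Linear k where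
  map_smul f c := ObjectProperty.hom_ext _ <| ModuleCat.hom_ext <| LinearMap.ext fun y =>
    (algebraMap_smul (MvPowerSeries (Fin n) k) c (ZeroPart.map he f y)).symm

theorem exists_splitting (hV : Module.finrank k V = n + 1) (hξ : ξ ≠ 0) :
    ∃ e : V ≃ₗ[k] k × (Fin n → k), e ξ = (1, 0) := by
  have hfin : Module.Finite k V := Module.finite_of_finrank_pos (by omega)
  obtain ⟨W, hW⟩ := Submodule.exists_isCompl (k ∙ ξ)
  have h1 := Submodule.finrank_add_eq_of_isCompl hW
  rw [finrank_span_singleton hξ, hV] at h1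
  have h2 : Module.finrank k W = Module.finrank k (Fin n → k) := by
    rw [Module.finrank_fin_fun]; omega
  refine ⟨(Submodule.prodEquivOfIsCompl _ _ hW).symm.trans
    ((LinearEquiv.toSpanNonzeroSingleton k V ξ hξ).symm.prodCongr
      (LinearEquiv.ofFinrankEq W (Fin n → k) h2)), ?_⟩
  have h3 : (Submodule.prodEquivOfIsCompl _ _ hW).symm ξ =
      (⟨ξ, Submodule.mem_span_singleton_self ξ⟩, 0) :=
    Submodule.prodEquivOfIsCompl_symm_apply_left _ _ hW ⟨ξ, Submodule.mem_span_singleton_self ξ⟩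
  rw [LinearEquiv.trans_apply, h3, LinearEquiv.prodCongr_apply, map_zero]
  congr 1
  exact LinearEquiv.coord_self k V ξ hξ

end ExteriorGraded

theorem theorem2p8 {k V : Type u} [Field k] [IsAlgClosed k] [AddCommGroup V] [Module k V]
    (n : ℕ) (hn : 0 < n) (hV : Module.finrank k V = n + 1) (ξ : V) (hξ : ξ ≠ 0) :
    ∃ (e : (ExteriorGraded.filteredBy (ExteriorGraded.cyclicMod (k := k) ξ)).FullSubcategory ≌
        (finDimPowerSeriesModule k n).FullSubcategory)
      (_ : e.functor.Additive),
      e.functor.Linear k := by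
  obtain ⟨e, he⟩ := ExteriorGraded.exists_splitting (k := k) hV hξ
  exact ⟨(ExteriorGraded.zeroPartFunctor he).asEquivalence,
    inferInstanceAs (ExteriorGraded.zeroPartFunctor he).Additive,
    inferInstanceAs ((ExteriorGraded.zeroPartFunctor he).Linear k)⟩
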